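/- Let $\nu\in C^2(\mathbb R)$ be $1$-periodic with $\nu\ge\kappa>0$ on $(0,1)$, let $f_1\in C^\infty(\mathbb R)$ be $1$-periodic, let $k\in\{0,1,2,\dots\}$, and for $0<\varepsilon\le 1$ let $D_\varepsilon=(0,1)\times(-\varepsilon/2,\varepsilon/2)$. Write $(\mathcal D u)_{ij}=\frac12(\partial_j u_i+\partial_i u_j)$ and $e_1=(1,0)$. Exact problem. Let $H^1_{per,1,0}(D_\varepsilon)$ be the completion in the $H^1(D_\varepsilon)$-norm of the $C^\infty(\mathbb R\times[-\frac\varepsilon2,\frac\varepsilon2])$ functions that are $1$-periodic in $x_1$ and vanish for $x_2=\pm\varepsilon/2$, and let $H_{per}(D_\varepsilon)=\{u\in (H^1_{per,1,0}(D_\varepsilon))^2:\operatorname{div}u=0\}$. A weak solution of the periodic Stokes problem $$-\operatorname{div}(\nu(x_1)\mathcal D u)+\nabla p=f_1(x_1)e_1,\qquad \operatorname{div}u=0\quad\text{in }D_\varepsilon,\qquad u|_{x_2=\pm\varepsilon/2}=0,\qquad u\ \text{$1$-periodic in }x_1,$$ is a $u\in H_{per}(D_\varepsilon)$ with $\int_{D_\varepsilon}\nu\,\mathcal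 D u:\mathcal D\psi=\int_{D_\varepsilon}f_1\psi_1$ for all $\psi\in H_{per}(D_\varepsilon)$; an associated pressure is a distribution $p\in\mathcal D'(D_\varepsilon)$ such that the first equation holds in $\mathcal D'(D_\varepsilon)$. Asymptotic solution. The regular ansatz of order $k$ is $$u_1^k=\sum_{j=0}^k\varepsilon^{j+2}u_{1,j}\Big(x_1,\frac{x_2}\varepsilon\Big),\quad u_2^k=\sum_{j=0}^k\varepsilon^{j+3}u_{2,j}\Big(x_1,\frac{x_2}\varepsilon\Big),\quad p^k=\sum_{j=0}^k\varepsilon^{j+1}p_j\Big(x_1,\frac{x_2}\varepsilon\Big)+\sum_{j=0}^k\varepsilon^jq_j(x_1),$$ where $u_{1,j},u_{2,j}$ (of class $C^2$) and $p_j,q_j$ (of class $C^1$), functions of $(x_1,\xi_2)\in\mathbb R\times[-\frac12,\frac12]$ (of $x_1$ only, for $q_j$) that are $1$-periodic in $x_1$, satisfy $\int_{-1/2}^{1/2}p_j\,d\xi_2=0$ and, for $0\le j\le k$ (functions with a negative index being $0$), $$-\partial_{x_1}(\nu\,\partial_{x_1}u_{1,j-2})-\tfrac{\nu}{2}\partial_{\xi_2}^2u_{1,j}-\tfrac{\nu}{2}\partial_{\xi_2}\partial_{x_1}u_{2,j-2}+\partial_{x_1}p_{j-1}+\partial_{x_1}q_j=f_1\delta_{j0},$$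 $$\tfrac12\partial_{x_1}\big[\nu(\partial_{\xi_2}u_{1,j-1}+\partial_{x_1}u_{2,j-3})\big]+\nu\,\partial_{\xi_2}^2u_{2,j-1}-\partial_{\xi_2}p_j=0,$$ $$\partial_{x_1}u_{1,j}+\partial_{\xi_2}u_{2,j}=0,\qquad u_{1,j}(x_1,\pm\tfrac12)=u_{2,j}(x_1,\pm\tfrac12)=0.$$ Then: 1. If $\nu\in C^\infty(\mathbb R)$, or if $k\le1$, such coefficients exist. 2. For every such family of coefficients there is a constant $C$, independent of $\varepsilon$, such that for every $\varepsilon\in(0,1]$, every weak solution $u$ and every associated pressure $p$, $$\|u^k-u\|_{(H^1(D_\varepsilon))^2}\le C\,\varepsilon^{k+5/2},\qquad \|\nabla p^k-\nabla p\|_{H^{-1}(D_\varepsilon)}\le C\,\varepsilon^{k+5/2},$$ where $H^{-1}(D_\varepsilon)$ is the dual of $(H^1_0(D_\varepsilon))^2$ normed by $\|\nabla\psi\|_{L^2(D_\varepsilon)}$. -/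

import Mathlib

open MeasureTheory TopologicalSpace
open scoped ENNReal ContDiff Distributions LineDeriv

noncomputable section

namespace ThinStokes

/-- The coordinate directions of the plane. -/
def dir (i : Fin 2) : ℝ × ℝ := if i = 0 then (1, 0) else (0, 1)

/-- Classical partial derivative of a function on the plane. -/
def pd (i : Fin 2) (w : ℝ × ℝ → ℝ) (x : ℝ × ℝ) : ℝ := fderiv ℝ w x (dir i)

/-- The thin domain `D_ε = (0,1) × (-ε/2, ε/2)`. -/
def strip (ε : ℝ) : Opens (ℝ × ℝ) :=
  ⟨Set.Ioo 0 1 ×ˢ Set.Ioo (-(ε / 2)) (ε / 2), isOpen_Ioo.prod isOpen_Ioo⟩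

/-- Lebesgue measure on an open set. -/
abbrev vol (Ω : Opens (ℝ × ℝ)) : Measure (ℝ × ℝ) := volume.restrict (Ω : Set (ℝ × ℝ))

/-! ### Sobolev norms -/

/-- `w ∈ H¹(Ω)`, with weak partial derivatives `g 0, g 1`. -/
structure HasWeakGrad (Ω : Opens (ℝ × ℝ)) (w : ℝ × ℝ → ℝ) (g : Fin 2 → ℝ × ℝ → ℝ) : Prop where
  memLp : MemLp w 2 (vol Ω)
  memLp_grad : ∀ j, MemLp (g j) 2 (vol Ω)
  weak : ∀ (j : Fin 2) (φ : 𝓓(Ω, ℝ)),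
    ∫ x in (Ω : Set (ℝ × ℝ)), w x * pd j φ x = -∫ x in (Ω : Set (ℝ × ℝ)), g j x * φ x

/-- The `H¹(Ω)²` norm of a vector field; it is `∞` if the field is not in `H¹(Ω)²`.
(Weak gradients are unique almost everywhere, so the infimum is over a single value.) -/
def h1Norm (Ω : Opens (ℝ × ℝ)) (w : Fin 2 → ℝ × ℝ → ℝ) : ℝ≥0∞ :=
  ⨅ (G : Fin 2 → Fin 2 → ℝ × ℝ → ℝ) (_ : ∀ i, HasWeakGrad Ω (w i) (G i)),
    (∑ i, (eLpNorm (w i) 2 (vol Ω) ^ 2 + ∑ j, eLpNorm (G i j) 2 (vol Ω) ^ 2)) ^ (1 / 2 : ℝ)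

/-- The `H⁻¹(Ω)` norm of a vector distribution (dual to `H¹₀(Ω)²`, the closure of the test
fields, with the norm `‖∇φ‖_{L²}`); it is `∞` if the distribution is not in `H⁻¹(Ω)²`. -/
def hMinusOneNorm (Ω : Opens (ℝ × ℝ)) (T : Fin 2 → 𝓓'(Ω, ℝ)) : ℝ≥0∞ :=
  ⨆ (φ : Fin 2 → 𝓓(Ω, ℝ))
    (_ : ∑ i, ∑ j, ∫ x in (Ω : Set (ℝ × ℝ)), (pd j (φ i) x) ^ 2 ≤ 1),
    ENNReal.ofReal |∑ i, T i (φ i)|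

/-- The distribution `φ ↦ ∫ g φ` on `Ω` given by a (locally integrable) function `g`. -/
def funDistribution (Ω : Opens (ℝ × ℝ)) (g : ℝ × ℝ → ℝ) : 𝓓'(Ω, ℝ) :=
  UniformConvergenceCLM.ofFun _ _ _
    (TestFunction.integralAgainstBilinCLM (ContinuousLinearMap.mul ℝ ℝ) volume g)

/-- The distributional gradient. -/
def grad {Ω : Opens (ℝ × ℝ)} (T : 𝓓'(Ω, ℝ)) (i : Fin 2) : 𝓓'(Ω, ℝ) := ∂_{dir i} T

/-! ### The periodic Stokes problem -/

/-- Functions smooth up to the boundary of `ℝ × [-ε/2, ε/2]`, `1`-periodic in `x₁` and vanishing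
for `x₂ = ± ε/2`. -/
structure IsPerSmooth (ε : ℝ) (φ : ℝ × ℝ → ℝ) : Prop where
  smooth : ContDiff ℝ ∞ φ
  periodic : ∀ s, ∀ t ∈ Set.Icc (-(ε / 2)) (ε / 2), φ (s + 1, t) = φ (s, t)
  top : ∀ s, φ (s, ε / 2) = 0
  bot : ∀ s, φ (s, -(ε / 2)) = 0

/-- `w ∈ H¹_{per,1,0}(D_ε)` with gradient `g`: the pair `(w, g)` is an `L²(D_ε)` limit of pairs
`(φ, ∇φ)` with `φ` as in `IsPerSmooth`. -/
structure MemHPer10 (ε : ℝ) (w : ℝ × ℝ → ℝ) (g : Fin 2 → ℝ × ℝ → ℝ) : Prop where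
  memLp : MemLp w 2 (vol (strip ε))
  memLp_grad : ∀ j, MemLp (g j) 2 (vol (strip ε))
  approx : ∀ δ : ℝ≥0∞, 0 < δ → ∃ φ, IsPerSmooth ε φ ∧
    eLpNorm (φ - w) 2 (vol (strip ε)) < δ ∧
    ∀ j, eLpNorm (pd j φ - g j) 2 (vol (strip ε)) < δ

/-- `v ∈ H_per(D_ε)`, the divergence-free fields in `H¹_{per,1,0}(D_ε)²`; here `G i j` is
`∂v_i/∂x_j`. -/
structure MemHPer (ε : ℝ) (v : Fin 2 → ℝ × ℝ → ℝ) (G : Fin 2 → Fin 2 → ℝ × ℝ → ℝ) : Prop where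
  comp : ∀ i, MemHPer10 ε (v i) (G i)
  div_free : ∀ᵐ x ∂(vol (strip ε)), G 0 0 x + G 1 1 x = 0

/-- The symmetrized gradient. -/
def symGrad (G : Fin 2 → Fin 2 → ℝ × ℝ → ℝ) (i j : Fin 2) (x : ℝ × ℝ) : ℝ :=
  (G i j x + G j i x) / 2

/-- The force `f₁(x₁) e₁`. -/
def force (f₁ : ℝ → ℝ) (i : Fin 2) (x : ℝ × ℝ) : ℝ := if i = 0 then f₁ x.1 else 0

/-- `u`, with gradient `G`, is the weak solution of the periodic Stokes problem in `D_ε` with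
viscosity `ν(x₁)` and force `f₁(x₁) e₁`. -/
structure IsWeakSolution (ν f₁ : ℝ → ℝ) (ε : ℝ) (u : Fin 2 → ℝ × ℝ → ℝ)
    (G : Fin 2 → Fin 2 → ℝ × ℝ → ℝ) : Prop where
  mem : MemHPer ε u G
  weak : ∀ ψ Ψ, MemHPer ε ψ Ψ →
    ∫ x in (strip ε : Set (ℝ × ℝ)), ν x.1 * ∑ i, ∑ j, symGrad G i j x * symGrad Ψ i j x =
      ∫ x in (strip ε : Set (ℝ × ℝ)), ∑ i, force f₁ i x * ψ i x

/-- `p` is a pressure for the velocity with gradient `G`: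
`-div(ν 𝒟u) + ∇p = f₁ e₁` in the sense of distributions on `D_ε`. -/
def IsPressure (ν f₁ : ℝ → ℝ) (ε : ℝ) (G : Fin 2 → Fin 2 → ℝ × ℝ → ℝ)
    (p : 𝓓'(strip ε, ℝ)) : Prop :=
  ∀ (i : Fin 2) (φ : 𝓓(strip ε, ℝ)),
    (∑ j, ∫ x in (strip ε : Set (ℝ × ℝ)), ν x.1 * symGrad G i j x * pd j φ x) + grad p i φ =
      ∫ x in (strip ε : Set (ℝ × ℝ)), force f₁ i x * φ x

/-! ### The regular ansatz -/

/-- Coefficients of the ansatz: `u₁ j`, `u₂ j`, `p j` are functions of `(x₁, ξ₂)` and `q j` of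
`x₁`. Only their values for `|ξ₂| ≤ 1/2` matter. -/
structure Coeffs where
  u₁ : ℕ → ℝ × ℝ → ℝ
  u₂ : ℕ → ℝ × ℝ → ℝ
  p : ℕ → ℝ × ℝ → ℝ
  q : ℕ → ℝ → ℝ

/-- The coefficient of index `j - m`, which is zero if `j - m` is negative. -/
def back (w : ℕ → ℝ × ℝ → ℝ) (j m : ℕ) : ℝ × ℝ → ℝ := if m ≤ j then w (j - m) else 0

/-- The coefficients of the ansatz of order `k`: periodic classical solutions, for `j ≤ k`, of the
recurrent system obtained by equating the powers of `ε`. -/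
structure IsAnsatz (ν f₁ : ℝ → ℝ) (k : ℕ) (a : Coeffs) : Prop where
  smooth_u₁ : ∀ j ≤ k, ContDiff ℝ 2 (a.u₁ j)
  smooth_u₂ : ∀ j ≤ k, ContDiff ℝ 2 (a.u₂ j)
  smooth_p : ∀ j ≤ k, ContDiff ℝ 1 (a.p j)
  smooth_q : ∀ j ≤ k, ContDiff ℝ 1 (a.q j)
  per_u₁ : ∀ j ≤ k, ∀ s, ∀ ξ ∈ Set.Icc (-(1 / 2) : ℝ) (1 / 2), a.u₁ j (s + 1, ξ) = a.u₁ j (s, ξ)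
  per_u₂ : ∀ j ≤ k, ∀ s, ∀ ξ ∈ Set.Icc (-(1 / 2) : ℝ) (1 / 2), a.u₂ j (s + 1, ξ) = a.u₂ j (s, ξ)
  per_p : ∀ j ≤ k, ∀ s, ∀ ξ ∈ Set.Icc (-(1 / 2) : ℝ) (1 / 2), a.p j (s + 1, ξ) = a.p j (s, ξ)
  per_q : ∀ j ≤ k, Function.Periodic (a.q j) 1
  mean_p : ∀ j ≤ k, ∀ s, ∫ ξ in (-(1 / 2) : ℝ)..(1 / 2), a.p j (s, ξ) = 0
  momentum₁ : ∀ j ≤ k, ∀ x : ℝ × ℝ, x.2 ∈ Set.Ioo (-(1 / 2) : ℝ) (1 / 2) →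
    -pd 0 (fun y => ν y.1 * pd 0 (back a.u₁ j 2) y) x
      - ν x.1 / 2 * pd 1 (pd 1 (a.u₁ j)) x
      - ν x.1 / 2 * pd 1 (pd 0 (back a.u₂ j 2)) x
      + pd 0 (back a.p j 1) x + deriv (a.q j) x.1 = if j = 0 then f₁ x.1 else 0
  momentum₂ : ∀ j ≤ k, ∀ x : ℝ × ℝ, x.2 ∈ Set.Ioo (-(1 / 2) : ℝ) (1 / 2) →
    1 / 2 * pd 0 (fun y => ν y.1 * (pd 1 (back a.u₁ j 1) y + pd 0 (back a.u₂ j 3) y)) x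
      + ν x.1 * pd 1 (pd 1 (back a.u₂ j 1)) x - pd 1 (a.p j) x = 0
  incompressible : ∀ j ≤ k, ∀ x : ℝ × ℝ, x.2 ∈ Set.Ioo (-(1 / 2) : ℝ) (1 / 2) →
    pd 0 (a.u₁ j) x + pd 1 (a.u₂ j) x = 0
  bdry_u₁ : ∀ j ≤ k, ∀ s, a.u₁ j (s, 1 / 2) = 0 ∧ a.u₁ j (s, -(1 / 2)) = 0
  bdry_u₂ : ∀ j ≤ k, ∀ s, a.u₂ j (s, 1 / 2) = 0 ∧ a.u₂ j (s, -(1 / 2)) = 0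

/-- The velocity `u^k` of the ansatz. -/
def Coeffs.velocity (a : Coeffs) (k : ℕ) (ε : ℝ) (i : Fin 2) (x : ℝ × ℝ) : ℝ :=
  if i = 0 then ∑ j ∈ Finset.range (k + 1), ε ^ (j + 2) * a.u₁ j (x.1, x.2 / ε)
  else ∑ j ∈ Finset.range (k + 1), ε ^ (j + 3) * a.u₂ j (x.1, x.2 / ε)

/-- The pressure `p^k` of the ansatz. -/
def Coeffs.pressure (a : Coeffs) (k : ℕ) (ε : ℝ) (x : ℝ × ℝ) : ℝ :=
  ∑ j ∈ Finset.range (k + 1), ε ^ (j + 1) * a.p j (x.1, x.2 / ε) +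
    ∑ j ∈ Finset.range (k + 1), ε ^ j * a.q j x.1

end ThinStokes

end

noncomputable section

namespace ThinStokes

/-!
The error `v = u^k - u` solves the Stokes system whose force is the residual of the ansatz, which
is `O(ε^{k+1})` uniformly: the terms left over by the recurrent system are exactly those of too
high an order. Testing the weak formulation with `v` itself (the pressure drops out because `v` is
divergence free), the Poincaré inequality in the thin direction gains a factor `ε` and the area of
`D_ε` a factor `ε^{1/2}`, whence `‖∇v‖ = O(ε^{k+5/2})`. Korn's inequality costs only a constant,
because `∑ ∂ᵢvⱼ ∂ⱼvᵢ` differs from `(div v)²` by a null Lagrangian. The pressure estimate is then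
read off the momentum equation.

The coefficients are found order by order. A stream function `Q`, with `u₁ = ∂Q/∂ξ₂` and
`u₂ = -∂Q/∂x₁`, turns the first momentum equation and the incompressibility into a third order
equation in `ξ₂`, and `q_j` is chosen so that the flux `Q(·, 1/2) - Q(·, -1/2)` is constant. The
force enters only through `q_0`, which absorbs everything but a multiple of `ν`.
-/

open Filter Set Topology

section SquareIntegrable

variable {α : Type*} {m : MeasurableSpace α} {μ : Measure α} {a b : α → ℝ}

lemma integrable_mul_of_memLp (ha : MemLp a 2 μ) (hb : MemLp b 2 μ) :
    Integrable (fun x => a x * b x) μ :=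
  ha.integrable_mul hb

lemma inner_toLp (ha : MemLp a 2 μ) (hb : MemLp b 2 μ) :
    inner ℝ (ha.toLp a) (hb.toLp b) = ∫ x, a x * b x ∂μ := by
  rw [L2.inner_def]
  refine integral_congr_ae ?_
  filter_upwards [ha.coeFn_toLp, hb.coeFn_toLp] with x hax hbx
  simp [hax, hbx, mul_comm]

lemma norm_toLp (ha : MemLp a 2 μ) : ‖ha.toLp a‖ = √(∫ x, a x ^ 2 ∂μ) := by
  rw [norm_eq_sqrt_real_inner, inner_toLp]
  simp_rw [sq]

lemma abs_integral_mul_le (ha : MemLp a 2 μ) (hb : MemLp b 2 μ) :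
    |∫ x, a x * b x ∂μ| ≤ √(∫ x, a x ^ 2 ∂μ) * √(∫ x, b x ^ 2 ∂μ) := by
  simpa only [inner_toLp, norm_toLp] using abs_real_inner_le_norm (ha.toLp a) (hb.toLp b)

lemma eLpNorm_two_sq (ha : MemLp a 2 μ) :
    eLpNorm a 2 μ ^ 2 = ENNReal.ofReal (∫ x, a x ^ 2 ∂μ) := by
  rw [← ENNReal.ofReal_toReal ha.eLpNorm_ne_top, ← Lp.norm_toLp a ha, norm_toLp,
    ← ENNReal.ofReal_pow (Real.sqrt_nonneg _),
    Real.sq_sqrt (integral_nonneg fun _ => sq_nonneg _)]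

lemma tendsto_integral_mul {ι : Type*} {l : Filter ι} {f g : ι → α → ℝ} (ha : MemLp a 2 μ)
    (hb : MemLp b 2 μ) (hf : ∀ n, MemLp (f n) 2 μ) (hg : ∀ n, MemLp (g n) 2 μ)
    (hfa : Tendsto (fun n => eLpNorm (f n - a) 2 μ) l (𝓝 0))
    (hgb : Tendsto (fun n => eLpNorm (g n - b) 2 μ) l (𝓝 0)) :
    Tendsto (fun n => ∫ x, f n x * g n x ∂μ) l (𝓝 (∫ x, a x * b x ∂μ)) := by
  have hF := (Lp.tendsto_Lp_iff_tendsto_eLpNorm'' f hf a ha).2 hfa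
  have hG := (Lp.tendsto_Lp_iff_tendsto_eLpNorm'' g hg b hb).2 hgb
  simpa only [inner_toLp] using hF.inner (𝕜 := ℝ) hG

end SquareIntegrable

/-! ### Partial derivatives -/

section PartialDerivatives

variable {v w : ℝ × ℝ → ℝ} {x : ℝ × ℝ} {i j : Fin 2}

lemma contDiff_pd {n m : WithTop ℕ∞} (hw : ContDiff ℝ n w) (h : m + 1 ≤ n) (i : Fin 2) :
    ContDiff ℝ m (pd i w) :=
  (hw.fderiv_right h).clm_apply contDiff_const

lemma continuous_pd (hw : ContDiff ℝ 1 w) (i : Fin 2) : Continuous (pd i w) :=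
  (contDiff_pd (m := 0) hw (by norm_num) i).continuous

lemma pd_add (hv : DifferentiableAt ℝ v x) (hw : DifferentiableAt ℝ w x) :
    pd i (fun y => v y + w y) x = pd i v x + pd i w x := by
  simp only [pd, fderiv_fun_add hv hw, _root_.add_apply]

lemma pd_sub (hv : DifferentiableAt ℝ v x) (hw : DifferentiableAt ℝ w x) :
    pd i (fun y => v y - w y) x = pd i v x - pd i w x := by
  simp only [pd, fderiv_fun_sub hv hw, _root_.sub_apply]

lemma pd_neg : pd i (fun y => -w y) x = -pd i w x := by
  simp only [pd, fderiv_fun_neg, _root_.neg_apply]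

lemma pd_mul (hv : DifferentiableAt ℝ v x) (hw : DifferentiableAt ℝ w x) :
    pd i (fun y => v y * w y) x = v x * pd i w x + pd i v x * w x := by
  simp only [pd, fderiv_fun_mul hv hw, _root_.add_apply, _root_.smul_apply, smul_eq_mul]
  ring

lemma pd_const_mul (c : ℝ) (hw : DifferentiableAt ℝ w x) :
    pd i (fun y => c * w y) x = c * pd i w x := by
  simp only [pd, fderiv_const_mul hw, _root_.smul_apply, smul_eq_mul]

lemma pd_sum {ι : Type*} (s : Finset ι) {f : ι → ℝ × ℝ → ℝ}
    (hf : ∀ n ∈ s, DifferentiableAt ℝ (f n) x) :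
    pd i (fun y => ∑ n ∈ s, f n y) x = ∑ n ∈ s, pd i (f n) x := by
  simp only [pd, fderiv_fun_sum hf, _root_.sum_apply]

lemma pd_const (c : ℝ) : pd i (fun _ => c) x = 0 := by
  simp [pd]

lemma pd_zero : pd i (0 : ℝ × ℝ → ℝ) = 0 :=
  funext fun _ => pd_const 0

lemma hasDerivAt_fst (hw : DifferentiableAt ℝ w x) :
    HasDerivAt (fun s => w (s, x.2)) (pd 0 w x) x.1 := by
  have h : HasDerivAt (fun s : ℝ => (s, x.2)) ((1 : ℝ), (0 : ℝ)) x.1 :=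
    (hasDerivAt_id _).prodMk (hasDerivAt_const _ _)
  exact (hw.hasFDerivAt (x := x)).comp_hasDerivAt (x := x.1) (f := fun s => (s, x.2)) h

lemma hasDerivAt_snd (hw : DifferentiableAt ℝ w x) :
    HasDerivAt (fun t => w (x.1, t)) (pd 1 w x) x.2 := by
  have h : HasDerivAt (fun t : ℝ => (x.1, t)) ((0 : ℝ), (1 : ℝ)) x.2 :=
    (hasDerivAt_const _ _).prodMk (hasDerivAt_id _)
  exact (hw.hasFDerivAt (x := x)).comp_hasDerivAt (x := x.2) (f := fun t => (x.1, t)) h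

lemma pd_fst_eq {c : ℝ} (hw : DifferentiableAt ℝ w x)
    (h : HasDerivAt (fun s => w (s, x.2)) c x.1) : pd 0 w x = c :=
  (hasDerivAt_fst hw).unique h

lemma pd_snd_eq {c : ℝ} (hw : DifferentiableAt ℝ w x)
    (h : HasDerivAt (fun t => w (x.1, t)) c x.2) : pd 1 w x = c :=
  (hasDerivAt_snd hw).unique h

lemma pd_zero_comp_fst {g : ℝ → ℝ} (hg : DifferentiableAt ℝ g x.1) :
    pd 0 (fun y : ℝ × ℝ => g y.1) x = deriv g x.1 :=
  pd_fst_eq (hg.comp x differentiableAt_fst) hg.hasDerivAt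

lemma pd_one_comp_fst {g : ℝ → ℝ} (hg : DifferentiableAt ℝ g x.1) :
    pd 1 (fun y : ℝ × ℝ => g y.1) x = 0 :=
  pd_snd_eq (hg.comp x differentiableAt_fst) (hasDerivAt_const x.2 (g x.1))

lemma pd_one_fst_mul {g : ℝ → ℝ} (hg : DifferentiableAt ℝ g x.1) (hw : DifferentiableAt ℝ w x) :
    pd 1 (fun y => g y.1 * w y) x = g x.1 * pd 1 w x :=
  pd_snd_eq ((hg.comp x differentiableAt_fst).mul hw) ((hasDerivAt_snd hw).const_mul (g x.1))

lemma pd_zero_fst_mul_snd {f g : ℝ → ℝ} (hf : Differentiable ℝ f) (hg : Differentiable ℝ g) :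
    pd 0 (fun y : ℝ × ℝ => f y.1 * g y.2) = fun y => deriv f y.1 * g y.2 :=
  funext fun y => pd_fst_eq (((hf.comp differentiable_fst).mul (hg.comp differentiable_snd)) y)
    ((hf y.1).hasDerivAt.mul_const (g y.2))

lemma pd_one_fst_mul_snd {f g : ℝ → ℝ} (hf : Differentiable ℝ f) (hg : Differentiable ℝ g) :
    pd 1 (fun y : ℝ × ℝ => f y.1 * g y.2) = fun y => f y.1 * deriv g y.2 :=
  funext fun y => pd_snd_eq (((hf.comp differentiable_fst).mul (hg.comp differentiable_snd)) y)
    ((hg y.2).hasDerivAt.const_mul (f y.1))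

lemma pd_comm (hw : ContDiff ℝ 2 w) : pd i (pd j w) x = pd j (pd i w) x := by
  have hd : DifferentiableAt ℝ (fderiv ℝ w) x :=
    (hw.fderiv_right (m := 1) (by norm_num)).differentiable one_ne_zero x
  have h (i j : Fin 2) : pd i (pd j w) x = fderiv ℝ (fderiv ℝ w) x (dir i) (dir j) := by
    change fderiv ℝ (fun y => fderiv ℝ w y (dir j)) x (dir i) = _
    rw [fderiv_clm_apply hd (differentiableAt_const _)]
    simp
  rw [h, h]
  exact (hw.contDiffAt.isSymmSndFDerivAt (by simp)).eq _ _

lemma pd_periodic {I : Set ℝ} {c t : ℝ} (hI : I ∈ 𝓝 t)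
    (h : ∀ s, ∀ t ∈ I, w (s + c, t) = w (s, t)) (i : Fin 2) (s : ℝ) :
    pd i w (s + c, t) = pd i w (s, t) := by
  have htranslate : (fun x => w (x + (c, 0))) =ᶠ[𝓝 (s, t)] w := by
    filter_upwards [prod_mem_nhds univ_mem hI] with y hy
    simpa [Prod.add_def] using h y.1 y.2 hy.2
  have heq := htranslate.fderiv_eq (𝕜 := ℝ)
  rw [fderiv_comp_add_right] at heq
  simpa [pd] using congr($heq (dir i))

end PartialDerivatives

/-! ### The thin strip -/

section Strip

variable {ε : ℝ} {f g φ : ℝ × ℝ → ℝ}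

lemma mem_strip {x : ℝ × ℝ} :
    x ∈ (strip ε : Set (ℝ × ℝ)) ↔ x.1 ∈ Ioo (0 : ℝ) 1 ∧ x.2 ∈ Ioo (-(ε / 2)) (ε / 2) :=
  Iff.rfl

lemma measurableSet_strip : MeasurableSet (strip ε : Set (ℝ × ℝ)) :=
  (strip ε).isOpen.measurableSet

lemma ae_vol_strip {P : ℝ × ℝ → Prop} (h : ∀ x ∈ (strip ε : Set (ℝ × ℝ)), P x) :
    ∀ᵐ x ∂vol (strip ε), P x :=
  (ae_restrict_iff' measurableSet_strip).2 (Eventually.of_forall h)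

lemma strip_subset_Icc :
    (strip ε : Set (ℝ × ℝ)) ⊆ Icc ((0, -(ε / 2)) : ℝ × ℝ) (1, ε / 2) := fun _ hx =>
  ⟨⟨hx.1.1.le, hx.2.1.le⟩, ⟨hx.1.2.le, hx.2.2.le⟩⟩

lemma volume_strip : volume (strip ε : Set (ℝ × ℝ)) = ENNReal.ofReal ε := by
  change volume (Ioo (0 : ℝ) 1 ×ˢ Ioo (-(ε / 2)) (ε / 2)) = _
  rw [Measure.volume_eq_prod, Measure.prod_prod, Real.volume_Ioo, Real.volume_Ioo]
  simp

instance isFiniteMeasure_vol_strip : IsFiniteMeasure (vol (strip ε)) :=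
  isFiniteMeasure_restrict.2 (by rw [volume_strip]; exact ENNReal.ofReal_ne_top)

lemma exists_bound_strip (hf : Continuous f) :
    ∃ C, 0 ≤ C ∧ ∀ x ∈ (strip ε : Set (ℝ × ℝ)), |f x| ≤ C := by
  obtain ⟨C, hC⟩ := (isCompact_Icc (a := ((0, -(ε / 2)) : ℝ × ℝ))
    (b := (1, ε / 2))).exists_bound_of_continuousOn hf.continuousOn
  exact ⟨|C|, abs_nonneg _, fun x hx => (hC x (strip_subset_Icc hx)).trans (le_abs_self C)⟩

lemma memLp_of_continuous (hf : Continuous f) : MemLp f 2 (vol (strip ε)) := by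
  obtain ⟨C, -, hC⟩ := exists_bound_strip (ε := ε) hf
  exact MemLp.of_bound hf.aestronglyMeasurable C (ae_vol_strip hC)

lemma memLp_mul_of_continuous (hf : Continuous f) (hg : MemLp g 2 (vol (strip ε))) :
    MemLp (fun x => f x * g x) 2 (vol (strip ε)) := by
  obtain ⟨C, -, hC⟩ := exists_bound_strip (ε := ε) hf
  refine MemLp.of_le_mul (c := C) hg (hf.aestronglyMeasurable.mul hg.1) ?_
  refine ae_vol_strip fun x hx => ?_
  rw [norm_mul]
  exact mul_le_mul_of_nonneg_right (hC x hx) (norm_nonneg _)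

lemma integral_strip_eq_integral_Icc (f : ℝ × ℝ → ℝ) :
    ∫ x, f x ∂vol (strip ε) = ∫ x in Icc ((0, -(ε / 2)) : ℝ × ℝ) (1, ε / 2), f x := by
  refine setIntegral_congr_set ?_
  rw [← Icc_prod_Icc, Measure.volume_eq_prod]
  exact Measure.set_prod_ae_eq Ioo_ae_eq_Icc Ioo_ae_eq_Icc

lemma integral_pd_eq_zero (hε : 0 < ε) (hf : ContDiff ℝ 1 f)
    (top : ∀ s, f (s, ε / 2) = 0) (bot : ∀ s, f (s, -(ε / 2)) = 0)
    (sides : ∀ t ∈ Ioo (-(ε / 2)) (ε / 2), f (1, t) = f (0, t)) (j : Fin 2) :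
    ∫ x, pd j f x ∂vol (strip ε) = 0 := by
  rw [integral_strip_eq_integral_Icc]
  have hle : ((0, -(ε / 2)) : ℝ × ℝ) ≤ (1, ε / 2) :=
    ⟨zero_le_one, by change -(ε / 2) ≤ ε / 2; linarith⟩
  have hd (x) : HasFDerivAt f (fderiv ℝ f x) x := (hf.differentiable one_ne_zero x).hasFDerivAt
  have h0 (x) : HasFDerivAt (fun _ : ℝ × ℝ => (0 : ℝ)) (0 : ℝ × ℝ →L[ℝ] ℝ) x :=
    hasFDerivAt_const _ _
  have hi (i) : IntegrableOn (pd i f) (Icc ((0, -(ε / 2)) : ℝ × ℝ) (1, ε / 2)) :=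
    (continuous_pd hf i).continuousOn.integrableOn_compact isCompact_Icc
  have sides' : ∫ t in (-(ε / 2))..(ε / 2), f (1, t) = ∫ t in (-(ε / 2))..(ε / 2), f (0, t) := by
    simp only [intervalIntegral.integral_of_le hle.2, integral_Ioc_eq_integral_Ioo]
    exact setIntegral_congr_fun measurableSet_Ioo sides
  fin_cases j
  · have := integral_divergence_prod_Icc_of_hasFDerivAt_of_le f (fun _ => 0) (fderiv ℝ f)
      (fun _ => 0) _ _ hle hf.continuous.continuousOn continuousOn_const (fun x _ => hd x)
      (fun x _ => h0 x) (by simp only [_root_.zero_apply, add_zero]; exact hi 0)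
    simpa [pd, dir, sides'] using this
  · have := integral_divergence_prod_Icc_of_hasFDerivAt_of_le (fun _ => 0) f (fun _ => 0)
      (fderiv ℝ f) _ _ hle continuousOn_const hf.continuous.continuousOn (fun x _ => h0 x)
      (fun x _ => hd x) (by simp only [_root_.zero_apply, zero_add]; exact hi 1)
    simpa [pd, dir, top, bot] using this

/-- A `C¹` function that vanishes on the horizontal sides of the strip and takes equal values at
opposite points of the vertical sides: the test functions for which integration by parts on
`strip ε` produces no boundary terms. -/
structure IsStripTest (ε : ℝ) (φ : ℝ × ℝ → ℝ) : Prop where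
  smooth : ContDiff ℝ 1 φ
  sides : ∀ t ∈ Ioo (-(ε / 2)) (ε / 2), φ (1, t) = φ (0, t)
  top : ∀ s, φ (s, ε / 2) = 0
  bot : ∀ s, φ (s, -(ε / 2)) = 0

lemma IsPerSmooth.isStripTest (h : IsPerSmooth ε φ) : IsStripTest ε φ where
  smooth := h.smooth.of_le (by exact_mod_cast le_top)
  sides t ht := by simpa using h.periodic 0 t (Ioo_subset_Icc_self ht)
  top := h.top
  bot := h.bot

lemma testFunction_eq_zero (φ : 𝓓(strip ε, ℝ)) {x : ℝ × ℝ} (hx : x ∉ (strip ε : Set (ℝ × ℝ))) :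
    φ x = 0 := by
  by_contra h
  exact hx (φ.tsupport_subset (subset_tsupport _ h))

lemma isStripTest_testFunction (φ : 𝓓(strip ε, ℝ)) : IsStripTest ε φ where
  smooth := φ.contDiff.of_le (by exact_mod_cast le_top)
  sides t _ := by
    rw [testFunction_eq_zero φ, testFunction_eq_zero φ] <;> simp [-SetLike.mem_coe, mem_strip]
  top s := testFunction_eq_zero φ (by simp [-SetLike.mem_coe, mem_strip])
  bot s := testFunction_eq_zero φ (by simp [-SetLike.mem_coe, mem_strip])

/-- `g` is the gradient of `w` in the sense of integration by parts against `C¹` functions with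
equal values at opposite points of the vertical sides. This is stronger than being a weak gradient:
it encodes that `w` is periodic and vanishes on the horizontal sides. -/
def IntegratesByParts (ε : ℝ) (w : ℝ × ℝ → ℝ) (g : Fin 2 → ℝ × ℝ → ℝ) : Prop :=
  ∀ a, ContDiff ℝ 1 a → (∀ t ∈ Ioo (-(ε / 2)) (ε / 2), a (1, t) = a (0, t)) → ∀ j,
    ∫ x, a x * g j x ∂vol (strip ε) = -∫ x, pd j a x * w x ∂vol (strip ε)

lemma IsStripTest.integratesByParts (hε : 0 < ε) (hφ : IsStripTest ε φ) :
    IntegratesByParts ε φ (fun j => pd j φ) := by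
  intro a ha hs j
  have h := integral_pd_eq_zero hε (f := fun x => a x * φ x) (ha.mul hφ.smooth)
    (fun s => by simp [hφ.top]) (fun s => by simp [hφ.bot])
    (fun t ht => by simp [hs t ht, hφ.sides t ht]) j
  simp_rw [fun x => pd_mul (i := j) (ha.differentiable one_ne_zero x)
    (hφ.smooth.differentiable one_ne_zero x)] at h
  rw [integral_add] at h
  · linarith
  · exact integrable_mul_of_memLp (memLp_of_continuous ha.continuous)
      (memLp_of_continuous (continuous_pd hφ.smooth j))
  · exact integrable_mul_of_memLp (memLp_of_continuous (continuous_pd ha j))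
      (memLp_of_continuous hφ.smooth.continuous)

lemma IsStripTest.integral_sq_eq (hε : 0 < ε) (hφ : IsStripTest ε φ) :
    ∫ x, φ x ^ 2 ∂vol (strip ε) = -2 * ∫ x, x.2 * φ x * pd 1 φ x ∂vol (strip ε) := by
  have hφ₀ : MemLp φ 2 (vol (strip ε)) := memLp_of_continuous hφ.smooth.continuous
  have hφ₁ : MemLp (pd 1 φ) 2 (vol (strip ε)) := memLp_of_continuous (continuous_pd hφ.smooth 1)
  have h := hφ.integratesByParts hε (fun x => x.2 * φ x) (contDiff_snd.mul hφ.smooth)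
    (fun t ht => by simp [hφ.sides t ht]) 1
  have hderiv (x) : pd 1 (fun x => x.2 * φ x) x * φ x = x.2 * φ x * pd 1 φ x + φ x ^ 2 := by
    rw [pd_mul differentiableAt_snd (hφ.smooth.differentiable one_ne_zero x),
      pd_snd_eq (w := Prod.snd) differentiableAt_snd (hasDerivAt_id _)]
    ring
  simp_rw [hderiv] at h
  rw [integral_add (integrable_mul_of_memLp (memLp_mul_of_continuous continuous_snd hφ₀) hφ₁)
    hφ₀.integrable_sq] at h
  linarith

lemma integral_sq_snd_mul_le (hg : MemLp g 2 (vol (strip ε))) :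
    ∫ x, (x.2 * g x) ^ 2 ∂vol (strip ε) ≤ (ε / 2) ^ 2 * ∫ x, g x ^ 2 ∂vol (strip ε) := by
  rw [← integral_const_mul]
  refine integral_mono_ae (memLp_mul_of_continuous continuous_snd hg).integrable_sq
    (hg.integrable_sq.const_mul _) (ae_vol_strip fun x hx => ?_)
  simp only [mul_pow]
  exact mul_le_mul_of_nonneg_right (sq_le_sq' hx.2.1.le hx.2.2.le) (sq_nonneg _)

lemma IsStripTest.integral_sq_le (hε : 0 < ε) (hφ : IsStripTest ε φ) :
    ∫ x, φ x ^ 2 ∂vol (strip ε) ≤ ε ^ 2 * ∫ x, pd 1 φ x ^ 2 ∂vol (strip ε) := by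
  have hφ₀ : MemLp φ 2 (vol (strip ε)) := memLp_of_continuous hφ.smooth.continuous
  have hφ₁ : MemLp (pd 1 φ) 2 (vol (strip ε)) := memLp_of_continuous (continuous_pd hφ.smooth 1)
  have hA : 0 ≤ ∫ x, φ x ^ 2 ∂vol (strip ε) := integral_nonneg fun _ => sq_nonneg _
  have hB : 0 ≤ ∫ x, pd 1 φ x ^ 2 ∂vol (strip ε) := integral_nonneg fun _ => sq_nonneg _
  have heq := hφ.integral_sq_eq hε
  have hcs := abs_integral_mul_le (memLp_mul_of_continuous continuous_snd hφ₀) hφ₁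
  have hsnd := Real.sqrt_le_sqrt (integral_sq_snd_mul_le hφ₀)
  rw [Real.sqrt_mul (sq_nonneg _), Real.sqrt_sq (by positivity)] at hsnd
  set A := ∫ x, φ x ^ 2 ∂vol (strip ε)
  set B := ∫ x, pd 1 φ x ^ 2 ∂vol (strip ε)
  have hle : √A * √A ≤ √A * (ε * √B) := calc
    √A * √A = A := Real.mul_self_sqrt hA
    _ ≤ 2 * |∫ x, x.2 * φ x * pd 1 φ x ∂vol (strip ε)| := by
      linarith [neg_abs_le (∫ x, x.2 * φ x * pd 1 φ x ∂vol (strip ε))]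
    _ ≤ 2 * (ε / 2 * √A * √B) := by gcongr; exact hcs.trans (by gcongr)
    _ = √A * (ε * √B) := by ring
  rcases hA.eq_or_lt with hA0 | hA0
  · rw [← hA0]
    positivity
  · have := le_of_mul_le_mul_left hle (Real.sqrt_pos.2 hA0)
    calc A = √A ^ 2 := (Real.sq_sqrt hA).symm
      _ ≤ (ε * √B) ^ 2 := by gcongr
      _ = ε ^ 2 * B := by rw [mul_pow, Real.sq_sqrt hB]

end Strip

/-! ### The space of periodic functions vanishing on the horizontal sides -/

section Periodic

variable {ε : ℝ} {w w' φ ψ : ℝ × ℝ → ℝ} {g g' : Fin 2 → ℝ × ℝ → ℝ}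

lemma IsPerSmooth.memLp (h : IsPerSmooth ε φ) : MemLp φ 2 (vol (strip ε)) :=
  memLp_of_continuous h.smooth.continuous

lemma IsPerSmooth.memLp_pd (h : IsPerSmooth ε φ) (j : Fin 2) :
    MemLp (pd j φ) 2 (vol (strip ε)) :=
  memLp_of_continuous (continuous_pd h.isStripTest.smooth j)

lemma IsPerSmooth.sub (hφ : IsPerSmooth ε φ) (hψ : IsPerSmooth ε ψ) :
    IsPerSmooth ε (fun x => φ x - ψ x) where
  smooth := hφ.smooth.sub hψ.smooth
  periodic s t ht := by rw [hφ.periodic s t ht, hψ.periodic s t ht]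
  top s := by rw [hφ.top, hψ.top, sub_zero]
  bot s := by rw [hφ.bot, hψ.bot, sub_zero]

lemma IsPerSmooth.pd_sides (h : IsPerSmooth ε φ) (i : Fin 2) {t : ℝ}
    (ht : t ∈ Ioo (-(ε / 2)) (ε / 2)) : pd i φ (1, t) = pd i φ (0, t) := by
  simpa using pd_periodic (Icc_mem_nhds ht.1 ht.2) h.periodic i 0

lemma MemHPer10.exists_seq (h : MemHPer10 ε w g) : ∃ φ : ℕ → ℝ × ℝ → ℝ,
    (∀ n, IsPerSmooth ε (φ n)) ∧
    Tendsto (fun n => eLpNorm (φ n - w) 2 (vol (strip ε))) atTop (𝓝 0) ∧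
    ∀ j, Tendsto (fun n => eLpNorm (pd j (φ n) - g j) 2 (vol (strip ε))) atTop (𝓝 0) := by
  choose φ hφ hφw hφg using fun n : ℕ =>
    h.approx (n : ℝ≥0∞)⁻¹ (ENNReal.inv_pos.2 (ENNReal.natCast_ne_top n))
  have hlim {a : ℕ → ℝ≥0∞} (ha : ∀ n : ℕ, a n < (n : ℝ≥0∞)⁻¹) : Tendsto a atTop (𝓝 0) :=
    tendsto_of_tendsto_of_tendsto_of_le_of_le tendsto_const_nhds
      ENNReal.tendsto_inv_nat_nhds_zero (fun _ => zero_le) fun n => (ha n).le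
  exact ⟨φ, hφ, hlim hφw, fun j => hlim fun n => hφg n j⟩

lemma MemHPer10.integratesByParts (hε : 0 < ε) (h : MemHPer10 ε w g) :
    IntegratesByParts ε w g := by
  intro a ha hs j
  obtain ⟨φ, hφ, hφw, hφg⟩ := h.exists_seq
  have ha₀ : MemLp a 2 (vol (strip ε)) := memLp_of_continuous ha.continuous
  have ha₁ : MemLp (pd j a) 2 (vol (strip ε)) := memLp_of_continuous (continuous_pd ha j)
  have hleft := tendsto_integral_mul ha₀ (h.memLp_grad j) (fun _ => ha₀)
    (fun n => (hφ n).memLp_pd j) (by simp) (hφg j)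
  have hright := tendsto_integral_mul ha₁ h.memLp (fun _ => ha₁)
    (fun n => (hφ n).memLp) (by simp) hφw
  exact tendsto_nhds_unique hleft (hright.neg.congr fun n =>
    ((hφ n).isStripTest.integratesByParts hε a ha hs j).symm)

lemma MemHPer10.integral_sq_le (hε : 0 < ε) (h : MemHPer10 ε w g) :
    ∫ x, w x ^ 2 ∂vol (strip ε) ≤ ε ^ 2 * ∫ x, g 1 x ^ 2 ∂vol (strip ε) := by
  obtain ⟨φ, hφ, hφw, hφg⟩ := h.exists_seq
  have hleft := tendsto_integral_mul h.memLp h.memLp (fun n => (hφ n).memLp)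
    (fun n => (hφ n).memLp) hφw hφw
  have hright := tendsto_integral_mul (h.memLp_grad 1) (h.memLp_grad 1)
    (fun n => (hφ n).memLp_pd 1) (fun n => (hφ n).memLp_pd 1) (hφg 1) (hφg 1)
  simp only [← sq] at hleft hright
  exact le_of_tendsto_of_tendsto' hleft (hright.const_mul (ε ^ 2)) fun n =>
    (hφ n).isStripTest.integral_sq_le hε

/-- `∂₁w ∂₀w' - ∂₀w ∂₁w'` is a null Lagrangian: this is what makes the Korn inequality an
identity for divergence-free fields. -/
lemma MemHPer10.integral_mul_comm (hε : 0 < ε) (h : MemHPer10 ε w g) (h' : MemHPer10 ε w' g') :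
    ∫ x, g 1 x * g' 0 x ∂vol (strip ε) = ∫ x, g 0 x * g' 1 x ∂vol (strip ε) := by
  obtain ⟨φ, hφ, -, hφg⟩ := h'.exists_seq
  have hleft := tendsto_integral_mul (h.memLp_grad 1) (h'.memLp_grad 0)
    (fun _ => h.memLp_grad 1) (fun n => (hφ n).memLp_pd 0) (by simp) (hφg 0)
  have hright := tendsto_integral_mul (h.memLp_grad 0) (h'.memLp_grad 1)
    (fun _ => h.memLp_grad 0) (fun n => (hφ n).memLp_pd 1) (by simp) (hφg 1)
  refine tendsto_nhds_unique hleft (hright.congr fun n => ?_)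
  have hφ₂ : ContDiff ℝ 2 (φ n) :=
    (hφ n).smooth.of_le (WithTop.coe_le_coe.2 (le_top : (2 : ℕ∞) ≤ ⊤))
  have hφ₁ : ∀ i, ContDiff ℝ 1 (pd i (φ n)) := contDiff_pd hφ₂ (by norm_num)
  have hby₀ := h.integratesByParts hε _ (hφ₁ 1) (fun t ht => (hφ n).pd_sides 1 ht) 0
  have hby₁ := h.integratesByParts hε _ (hφ₁ 0) (fun t ht => (hφ n).pd_sides 0 ht) 1
  simp_rw [pd_comm (i := 0) (j := 1) hφ₂] at hby₀
  simp_rw [mul_comm (g _ _)]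
  rw [hby₀, hby₁]

lemma eLpNorm_sub_sub_sub_lt {α : Type*} {m : MeasurableSpace α} {μ : Measure α}
    {p : ℝ≥0∞} (hp : 1 ≤ p) {a b c d : α → ℝ} {δ : ℝ≥0∞} (hab : AEStronglyMeasurable (a - b) μ)
    (hcd : AEStronglyMeasurable (c - d) μ) (h : eLpNorm (a - b) p μ < δ / 2)
    (h' : eLpNorm (c - d) p μ < δ / 2) : eLpNorm ((a - c) - (b - d)) p μ < δ := by
  rw [sub_sub_sub_comm]
  calc _ ≤ eLpNorm (a - b) p μ + eLpNorm (c - d) p μ := eLpNorm_sub_le hab hcd hp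
    _ < δ / 2 + δ / 2 := ENNReal.add_lt_add h h'
    _ = δ := ENNReal.add_halves δ

lemma MemHPer10.sub (h : MemHPer10 ε w g) (h' : MemHPer10 ε w' g') :
    MemHPer10 ε (w - w') (fun j => g j - g' j) where
  memLp := h.memLp.sub h'.memLp
  memLp_grad j := (h.memLp_grad j).sub (h'.memLp_grad j)
  approx δ hδ := by
    obtain ⟨φ, hφ, hφw, hφg⟩ := h.approx _ (ENNReal.half_pos hδ.ne')
    obtain ⟨ψ, hψ, hψw, hψg⟩ := h'.approx _ (ENNReal.half_pos hδ.ne')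
    refine ⟨_, hφ.sub hψ, eLpNorm_sub_sub_sub_lt one_le_two (hφ.memLp.sub h.memLp).1
      (hψ.memLp.sub h'.memLp).1 hφw hψw, fun j => ?_⟩
    have hpd : pd j (fun x => φ x - ψ x) = pd j φ - pd j ψ := funext fun x =>
      pd_sub (hφ.smooth.differentiable (by simp) x) (hψ.smooth.differentiable (by simp) x)
    rw [hpd]
    exact eLpNorm_sub_sub_sub_lt one_le_two ((hφ.memLp_pd j).sub (h.memLp_grad j)).1
      ((hψ.memLp_pd j).sub (h'.memLp_grad j)).1 (hφg j) (hψg j)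

lemma MemHPer10.hasWeakGrad (hε : 0 < ε) (h : MemHPer10 ε w g) : HasWeakGrad (strip ε) w g where
  memLp := h.memLp
  memLp_grad := h.memLp_grad
  weak j φ := by
    have hφ := isStripTest_testFunction φ
    simp_rw [mul_comm (w _), mul_comm (g _ _)]
    rw [h.integratesByParts hε φ hφ.smooth hφ.sides j, neg_neg]

end Periodic

/-! ### Density of smooth functions -/

section Mollification

open scoped Convolution
open ContinuousLinearMap (lsmul)

variable {E F : Type*} [NormedAddCommGroup E] [NormedSpace ℝ E] [FiniteDimensional ℝ E]
  [MeasurableSpace E] [BorelSpace E] {μ : Measure E} [μ.IsAddHaarMeasure]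
  [NormedAddCommGroup F] [NormedSpace ℝ F] {η : E → ℝ} {v : E → F}

/-- Unlike in `HasCompactSupport.hasFDerivAt_convolution_right`, the support that is compact is
that of the factor which is not differentiated. -/
lemma hasFDerivAt_convolution_of_hasCompactSupport (hη : Continuous η) (hc : HasCompactSupport η)
    (hv : ContDiff ℝ 1 v) (x : E) :
    HasFDerivAt (η ⋆[lsmul ℝ ℝ, μ] v) ((η ⋆[lsmul ℝ ℝ, μ] fderiv ℝ v) x) x := by
  have : ProperSpace E := FiniteDimensional.proper ℝ E
  have hfc : Continuous (fderiv ℝ v) := hv.continuous_fderiv one_ne_zero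
  obtain ⟨M, hM⟩ := (hc.isCompact.prod (isCompact_closedBall x 1)).exists_bound_of_continuousOn
    (f := fun q : E × E => fderiv ℝ v (q.2 - q.1))
    (hfc.comp (continuous_snd.sub continuous_fst)).continuousOn
  have hF (z) : Continuous fun y => η y • v (z - y) :=
    hη.smul (hv.continuous.comp (continuous_const.sub continuous_id))
  have hF' : Continuous fun y => η y • fderiv ℝ v (x - y) :=
    hη.smul (hfc.comp (continuous_const.sub continuous_id))
  refine hasFDerivAt_integral_of_dominated_of_fderiv_le (s := Metric.ball x 1)
    (bound := fun y => |η y| * M) (F' := fun z y => η y • fderiv ℝ v (z - y))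
    (Metric.ball_mem_nhds x one_pos) (.of_forall fun z => (hF z).aestronglyMeasurable)
    ((hF x).integrable_of_hasCompactSupport hc.smul_right) hF'.aestronglyMeasurable
    (.of_forall fun y z hz => ?_) ((hη.abs.integrable_of_hasCompactSupport hc.abs).mul_const M)
    (.of_forall fun y z _ => ?_)
  · rw [norm_smul, Real.norm_eq_abs]
    by_cases hy : y ∈ tsupport η
    · exact mul_le_mul_of_nonneg_left (hM (y, z) ⟨hy, Metric.ball_subset_closedBall hz⟩)
        (abs_nonneg _)
    · simp [image_eq_zero_of_notMem_tsupport hy]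
  · exact ((hv.differentiable one_ne_zero (z - y)).hasFDerivAt.comp z
      ((hasFDerivAt_id z).sub_const y)).const_smul (η y)

lemma exists_dist_normed_convolution_le [CompleteSpace F] (hv : Continuous v)
    {K : Set E} (hK : IsCompact K) {δ : ℝ} (hδ : 0 < δ) :
    ∃ r > 0, ∀ b : ContDiffBump (0 : E), b.rOut ≤ r →
      ∀ x ∈ K, dist ((b.normed μ ⋆[lsmul ℝ ℝ, μ] v) x) (v x) ≤ δ := by
  have : ProperSpace E := FiniteDimensional.proper ℝ E
  obtain ⟨r, hr, hvr⟩ := Metric.mem_uniformity_dist.1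
    (hK.uniformContinuousAt_of_continuousAt v (fun x _ => hv.continuousAt)
      (Metric.dist_mem_uniformity hδ))
  refine ⟨r, hr, fun b hb x hx => ?_⟩
  refine ContDiffBump.dist_normed_convolution_le hv.aestronglyMeasurable fun y hy => ?_
  rw [dist_comm]
  exact (hvr (dist_comm x y ▸ (Metric.mem_ball.1 hy).trans_le hb) hx).le

end Mollification

section Density

open scoped Convolution
open ContinuousLinearMap (lsmul)

variable {ε a c : ℝ} {w φ : ℝ × ℝ → ℝ} {K : Set (ℝ × ℝ)}

/-- The map `(x₁, x₂) ↦ (x₁, (1 - θ) x₂)`. Composing with it makes a function that is periodic on a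
closed horizontal strip periodic on a larger one, which leaves room for mollification. -/
def contraction (θ : ℝ) : ℝ × ℝ →L[ℝ] ℝ × ℝ :=
  ContinuousLinearMap.id ℝ _ - θ • (ContinuousLinearMap.inr ℝ ℝ ℝ).comp
    (ContinuousLinearMap.snd ℝ ℝ ℝ)

lemma contraction_apply (θ : ℝ) (x : ℝ × ℝ) : contraction θ x = (x.1, (1 - θ) * x.2) := by
  ext <;> simp [contraction, sub_mul]

lemma contraction_zero : contraction 0 = ContinuousLinearMap.id ℝ (ℝ × ℝ) := by
  simp [contraction]

lemma continuous_contraction : Continuous contraction := by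
  unfold contraction
  fun_prop

lemma fderiv_comp_contraction (hw : Differentiable ℝ w) (θ : ℝ) (x : ℝ × ℝ) :
    fderiv ℝ (w ∘ contraction θ) x = (fderiv ℝ w (contraction θ x)).comp (contraction θ) := by
  rw [fderiv_comp x (hw _) (contraction θ).differentiableAt, ContinuousLinearMap.fderiv]

lemma eventually_dist_comp_contraction_lt (hw : ContDiff ℝ 1 w) (hK : IsCompact K) {δ : ℝ}
    (hδ : 0 < δ) : ∀ᶠ θ in 𝓝 0, ∀ x ∈ K,
      dist ((w ∘ contraction θ) x) (w x) < δ ∧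
      dist (fderiv ℝ (w ∘ contraction θ) x) (fderiv ℝ w x) < δ := by
  have happly : Continuous fun z : ℝ × (ℝ × ℝ) => contraction z.1 z.2 :=
    (continuous_contraction.comp continuous_fst).clm_apply continuous_snd
  have hvalue : Continuous fun z : ℝ × (ℝ × ℝ) => dist (w (contraction z.1 z.2)) (w z.2) :=
    (hw.continuous.comp happly).dist (hw.continuous.comp continuous_snd)
  have hfc : Continuous (fderiv ℝ w) := hw.continuous_fderiv one_ne_zero
  have hderiv : Continuous fun z : ℝ × (ℝ × ℝ) =>
      dist ((fderiv ℝ w (contraction z.1 z.2)).comp (contraction z.1)) (fderiv ℝ w z.2) :=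
    ((hfc.comp happly).clm_comp (continuous_contraction.comp continuous_fst)).dist
      (hfc.comp continuous_snd)
  refine hK.eventually_forall_of_forall_eventually fun x _ => ?_
  simp only [fderiv_comp_contraction (hw.differentiable one_ne_zero), Function.comp_apply]
  exact (hvalue.continuousAt.eventually_lt_const (by simpa [contraction_zero] using hδ)).and
    (hderiv.continuousAt.eventually_lt_const (by simpa [contraction_zero] using hδ))

lemma convolution_comp_contraction_periodic {η : ℝ × ℝ → ℝ} {θ : ℝ} (hθ : θ ∈ Icc (0 : ℝ) 1)
    (hη : Function.support η ⊆ Metric.ball 0 (θ * a))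
    (hper : ∀ s, ∀ t ∈ Icc (-a) a, w (s + c, t) = w (s, t)) (s : ℝ) {t : ℝ}
    (ht : t ∈ Icc (-a) a) :
    (η ⋆[lsmul ℝ ℝ, volume] (w ∘ contraction θ)) (s + c, t) =
      (η ⋆[lsmul ℝ ℝ, volume] (w ∘ contraction θ)) (s, t) := by
  refine integral_congr_ae (.of_forall fun y => ?_)
  by_cases hy : y ∈ Function.support η
  · have hy₂ := abs_lt.1 ((norm_snd_le y).trans_lt (mem_ball_zero_iff.1 (hη hy)))
    simp only [ContinuousLinearMap.lsmul_apply, Function.comp_apply, contraction_apply,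
      Prod.fst_sub, Prod.snd_sub, add_sub_right_comm s]
    rw [hper _ _ ⟨by nlinarith [ht.1, hθ.1, hθ.2], by nlinarith [ht.2, hθ.1, hθ.2]⟩]
  · simp [Function.notMem_support.1 hy]

lemma abs_pd_sub_le (φ w : ℝ × ℝ → ℝ) (x : ℝ × ℝ) (j : Fin 2) :
    |pd j φ x - pd j w x| ≤ dist (fderiv ℝ φ x) (fderiv ℝ w x) := by
  have hdir : ‖dir j‖ ≤ 1 := by fin_cases j <;> simp [dir, Prod.norm_def]
  rw [dist_eq_norm]
  exact (fderiv ℝ φ x - fderiv ℝ w x).unit_le_opNorm _ hdir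

lemma exists_smooth_periodic_approx (ha : 0 < a) (hw : ContDiff ℝ 1 w)
    (hper : ∀ s, ∀ t ∈ Icc (-a) a, w (s + c, t) = w (s, t)) (hK : IsCompact K) {δ : ℝ}
    (hδ : 0 < δ) :
    ∃ φ : ℝ × ℝ → ℝ, ContDiff ℝ ∞ φ ∧ (∀ s, ∀ t ∈ Icc (-a) a, φ (s + c, t) = φ (s, t)) ∧
      ∀ x ∈ K, |φ x - w x| ≤ δ ∧ ∀ j, |pd j φ x - pd j w x| ≤ δ := by
  obtain ⟨θ, ⟨hθw, hθ1⟩, hθ0⟩ :=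
    (((eventually_dist_comp_contraction_lt hw hK (half_pos hδ)).and
      (eventually_le_nhds one_pos)).filter_mono nhdsWithin_le_nhds |>.and
        (self_mem_nhdsWithin (s := Ioi (0 : ℝ)))).exists
  have hv : ContDiff ℝ 1 (w ∘ contraction θ) := hw.comp (contraction θ).contDiff
  obtain ⟨r₀, hr₀, hvalue⟩ := exists_dist_normed_convolution_le (μ := volume) hv.continuous hK
    (half_pos hδ)
  obtain ⟨r₁, hr₁, hderiv⟩ := exists_dist_normed_convolution_le (μ := volume)
    (hv.continuous_fderiv one_ne_zero) hK (half_pos hδ)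
  have hr : 0 < min (min r₀ r₁) (θ * a) := lt_min (lt_min hr₀ hr₁) (mul_pos hθ0 ha)
  let b : ContDiffBump (0 : ℝ × ℝ) := ⟨_, _, half_pos hr, half_lt_self hr⟩
  have hb₀ : b.rOut ≤ r₀ := (min_le_left _ _).trans (min_le_left _ _)
  have hb₁ : b.rOut ≤ r₁ := (min_le_left _ _).trans (min_le_right _ _)
  have hsupp : Function.support (b.normed volume) ⊆ Metric.ball 0 (θ * a) :=
    b.support_normed_eq.subset.trans (Metric.ball_subset_ball (min_le_right _ _))
  refine ⟨b.normed volume ⋆[lsmul ℝ ℝ, volume] (w ∘ contraction θ),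
    b.hasCompactSupport_normed.contDiff_convolution_left _ b.contDiff_normed
      hv.continuous.locallyIntegrable,
    fun s t ht => convolution_comp_contraction_periodic ⟨(mem_Ioi.1 hθ0).le, hθ1⟩ hsupp hper s ht,
    fun x hx => ⟨?_, fun j => (abs_pd_sub_le _ _ x j).trans ?_⟩⟩
  · rw [← Real.dist_eq, ← add_halves δ]
    exact (dist_triangle _ _ _).trans (add_le_add (hvalue b hb₀ x hx) (hθw x hx).1.le)
  · rw [(hasFDerivAt_convolution_of_hasCompactSupport b.continuous_normed
      b.hasCompactSupport_normed hv x).fderiv, ← add_halves δ]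
    exact (dist_triangle _ _ _).trans (add_le_add (hderiv b hb₁ x hx) (hθw x hx).2.le)

/-- The function affine in `x₂` that agrees with `φ` on the lines `x₂ = ± ε/2`; subtracting it
enforces the boundary condition of `IsPerSmooth`. -/
def boundaryInterp (ε : ℝ) (φ : ℝ × ℝ → ℝ) (x : ℝ × ℝ) : ℝ :=
  (1 / 2 + x.2 / ε) * φ (x.1, ε / 2) + (1 / 2 - x.2 / ε) * φ (x.1, -(ε / 2))

lemma contDiff_boundaryInterp {n : WithTop ℕ∞} (hφ : ContDiff ℝ n φ) :
    ContDiff ℝ n (boundaryInterp ε φ) :=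
  ((contDiff_const.add (contDiff_snd.div_const ε)).mul
    (hφ.comp (contDiff_fst.prodMk contDiff_const))).add
  ((contDiff_const.sub (contDiff_snd.div_const ε)).mul
    (hφ.comp (contDiff_fst.prodMk contDiff_const)))

lemma pd_fst_boundaryInterp (hφ : ContDiff ℝ 1 φ) (x : ℝ × ℝ) :
    pd 0 (boundaryInterp ε φ) x = boundaryInterp ε (pd 0 φ) x := by
  have hd (t : ℝ) : HasDerivAt (fun s => φ (s, t)) (pd 0 φ (x.1, t)) x.1 :=
    hasDerivAt_fst (x := (x.1, t)) (hφ.differentiable one_ne_zero _)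
  exact pd_fst_eq ((contDiff_boundaryInterp hφ).differentiable one_ne_zero x)
    (((hd (ε / 2)).const_mul (1 / 2 + x.2 / ε)).fun_add
      ((hd (-(ε / 2))).const_mul (1 / 2 - x.2 / ε)))

lemma pd_snd_boundaryInterp (hφ : ContDiff ℝ 1 φ) (x : ℝ × ℝ) :
    pd 1 (boundaryInterp ε φ) x = (φ (x.1, ε / 2) - φ (x.1, -(ε / 2))) / ε := by
  have hd := (hasDerivAt_id x.2).div_const ε
  refine pd_snd_eq ((contDiff_boundaryInterp hφ).differentiable one_ne_zero x) ?_
  exact (((hd.const_add (1 / 2)).mul_const (φ (x.1, ε / 2))).fun_add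
    ((hd.const_sub (1 / 2)).mul_const (φ (x.1, -(ε / 2))))).congr_deriv (by ring)

lemma abs_boundaryInterp_le (hε : 0 < ε) {x : ℝ × ℝ} (hx : x.2 ∈ Icc (-(ε / 2)) (ε / 2))
    (htop : |φ (x.1, ε / 2)| ≤ c) (hbot : |φ (x.1, -(ε / 2))| ≤ c) :
    |boundaryInterp ε φ x| ≤ c := by
  have h₁ : 0 ≤ 1 / 2 + x.2 / ε := by
    rw [← neg_le_iff_add_nonneg', le_div_iff₀ hε]
    linarith [hx.1]
  have h₂ : 0 ≤ 1 / 2 - x.2 / ε := by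
    rw [sub_nonneg, div_le_iff₀ hε]
    linarith [hx.2]
  calc |boundaryInterp ε φ x|
      ≤ (1 / 2 + x.2 / ε) * |φ (x.1, ε / 2)| + (1 / 2 - x.2 / ε) * |φ (x.1, -(ε / 2))| := by
        refine (abs_add_le _ _).trans_eq ?_
        rw [abs_mul, abs_mul, abs_of_nonneg h₁, abs_of_nonneg h₂]
    _ ≤ (1 / 2 + x.2 / ε) * c + (1 / 2 - x.2 / ε) * c := by gcongr
    _ = c := by ring

lemma isPerSmooth_sub_boundaryInterp (hε : 0 < ε) (hφ : ContDiff ℝ ∞ φ)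
    (hper : ∀ s, ∀ t ∈ Icc (-(ε / 2)) (ε / 2), φ (s + 1, t) = φ (s, t)) :
    IsPerSmooth ε (fun x => φ x - boundaryInterp ε φ x) where
  smooth := hφ.sub (contDiff_boundaryInterp hφ)
  periodic s t ht := by
    have hle : -(ε / 2) ≤ ε / 2 := by linarith
    simp only [boundaryInterp, hper s t ht, hper s _ (right_mem_Icc.2 hle),
      hper s _ (left_mem_Icc.2 hle)]
  top s := by simp only [boundaryInterp]; field_simp; ring
  bot s := by simp only [boundaryInterp]; field_simp; ring

lemma abs_sub_sub_le (r s t : ℝ) : |r - s - t| ≤ |r - t| + |s| := by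
  rw [sub_right_comm]
  exact abs_sub _ _

lemma abs_pd_sub_boundaryInterp_sub_le (hε : 0 < ε) (hφ : ContDiff ℝ 1 φ) {x : ℝ × ℝ}
    (hx : x.2 ∈ Icc (-(ε / 2)) (ε / 2)) (hpd : ∀ j, |pd j φ x - pd j w x| ≤ c)
    (htop : |φ (x.1, ε / 2)| ≤ c) (hbot : |φ (x.1, -(ε / 2))| ≤ c)
    (htop₀ : |pd 0 φ (x.1, ε / 2)| ≤ c) (hbot₀ : |pd 0 φ (x.1, -(ε / 2))| ≤ c) (j : Fin 2) :
    |pd j (fun x => φ x - boundaryInterp ε φ x) x - pd j w x| ≤ c * (2 + 2 / ε) := by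
  have hc : 0 ≤ c := (abs_nonneg _).trans htop
  have hcε : 0 ≤ 2 * c / ε := by positivity
  rw [pd_sub (hφ.differentiable one_ne_zero _)
    ((contDiff_boundaryInterp hφ).differentiable one_ne_zero _)]
  refine (abs_sub_sub_le _ _ _).trans ?_
  have hsum : c * (2 + 2 / ε) = 2 * c + 2 * c / ε := by ring
  fin_cases j
  · have := abs_boundaryInterp_le hε hx htop₀ hbot₀
    simp only [Fin.zero_eta, pd_fst_boundaryInterp hφ]
    linarith [hpd 0]
  · have : |(φ (x.1, ε / 2) - φ (x.1, -(ε / 2))) / ε| ≤ 2 * c / ε := by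
      rw [abs_div, abs_of_pos hε]
      gcongr
      linarith [abs_sub (φ (x.1, ε / 2)) (φ (x.1, -(ε / 2)))]
    simp only [Fin.mk_one, pd_snd_boundaryInterp hφ]
    linarith [hpd 1]

lemma exists_isPerSmooth_approx (hε : 0 < ε) (hw : ContDiff ℝ 1 w)
    (hper : ∀ s, ∀ t ∈ Icc (-(ε / 2)) (ε / 2), w (s + 1, t) = w (s, t))
    (top : ∀ s, w (s, ε / 2) = 0) (bot : ∀ s, w (s, -(ε / 2)) = 0) {d : ℝ} (hd : 0 < d) :
    ∃ ψ, IsPerSmooth ε ψ ∧ ∀ x ∈ (strip ε : Set (ℝ × ℝ)),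
      |ψ x - w x| ≤ d ∧ ∀ j, |pd j ψ x - pd j w x| ≤ d := by
  obtain ⟨c, hc, rfl⟩ : ∃ c > 0, c * (2 + 2 / ε) = d :=
    ⟨d / (2 + 2 / ε), by positivity, by field_simp⟩
  obtain ⟨φ, hφ, hφper, happrox⟩ := exists_smooth_periodic_approx (half_pos hε) hw hper
    (isCompact_Icc.prod isCompact_Icc : IsCompact (Icc (0 : ℝ) 1 ×ˢ Icc (-(ε / 2)) (ε / 2))) hc
  refine ⟨_, isPerSmooth_sub_boundaryInterp hε hφ hφper, fun ⟨s, t⟩ ⟨hs, ht⟩ => ?_⟩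
  have hs' := Ioo_subset_Icc_self hs
  have ht' := Ioo_subset_Icc_self ht
  have hle : -(ε / 2) ≤ ε / 2 := by linarith
  obtain ⟨hφw, hpd⟩ := happrox (s, t) ⟨hs', ht'⟩
  obtain ⟨htop, htop'⟩ := happrox (s, ε / 2) ⟨hs', right_mem_Icc.2 hle⟩
  obtain ⟨hbot, hbot'⟩ := happrox (s, -(ε / 2)) ⟨hs', left_mem_Icc.2 hle⟩
  have hw₀ {t : ℝ} (h : ∀ s, w (s, t) = 0) : pd 0 w (s, t) = 0 :=
    pd_fst_eq (hw.differentiable one_ne_zero _) (by simpa only [h] using hasDerivAt_const _ _)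
  rw [top, sub_zero] at htop
  rw [bot, sub_zero] at hbot
  refine ⟨(abs_sub_sub_le _ _ _).trans ?_, abs_pd_sub_boundaryInterp_sub_le hε
    (hφ.of_le (by exact_mod_cast le_top)) ht' hpd htop hbot
    (by simpa [hw₀ top] using htop' 0) (by simpa [hw₀ bot] using hbot' 0)⟩
  have := abs_boundaryInterp_le hε (x := (s, t)) ht' htop hbot
  have : 0 ≤ c * (2 / ε) := by positivity
  linarith

lemma exists_eLpNorm_lt_of_ae_norm_le {α : Type*} {m : MeasurableSpace α} (μ : Measure α)
    [IsFiniteMeasure μ] (p : ℝ≥0∞) {δ : ℝ≥0∞} (hδ : 0 < δ) :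
    ∃ d > 0, ∀ f : α → ℝ, (∀ᵐ x ∂μ, ‖f x‖ ≤ d) → eLpNorm f p μ < δ := by
  have hfin : μ univ ^ p.toReal⁻¹ ≠ ⊤ :=
    ENNReal.rpow_ne_top_of_nonneg (by positivity) (measure_ne_top _ _)
  have hlim : Tendsto (fun d : ℝ => μ univ ^ p.toReal⁻¹ * ENNReal.ofReal d) (𝓝[>] 0) (𝓝 0) := by
    have := ENNReal.Tendsto.const_mul ((ENNReal.continuous_ofReal.tendsto 0).mono_left
      (nhdsWithin_le_nhds (s := Ioi (0 : ℝ)))) (Or.inr hfin)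
    simpa using this
  obtain ⟨d, hd, hd0⟩ := ((hlim.eventually_lt_const hδ).and self_mem_nhdsWithin).exists
  exact ⟨d, hd0, fun f hf => (eLpNorm_le_of_ae_bound hf).trans_lt hd⟩

lemma memHPer10_of_contDiff (hε : 0 < ε) (hw : ContDiff ℝ 1 w)
    (hper : ∀ s, ∀ t ∈ Icc (-(ε / 2)) (ε / 2), w (s + 1, t) = w (s, t))
    (top : ∀ s, w (s, ε / 2) = 0) (bot : ∀ s, w (s, -(ε / 2)) = 0) :
    MemHPer10 ε w (fun j => pd j w) where
  memLp := memLp_of_continuous hw.continuous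
  memLp_grad j := memLp_of_continuous (continuous_pd hw j)
  approx δ hδ := by
    obtain ⟨d, hd, hlt⟩ := exists_eLpNorm_lt_of_ae_norm_le (vol (strip ε)) 2 hδ
    obtain ⟨ψ, hψ, happrox⟩ := exists_isPerSmooth_approx hε hw hper top bot hd
    exact ⟨ψ, hψ, hlt _ (ae_vol_strip fun x hx => (happrox x hx).1),
      fun j => hlt _ (ae_vol_strip fun x hx => (happrox x hx).2 j)⟩

end Density

/-! ### The energy estimate -/

section Energy

variable {ν f₁ : ℝ → ℝ} {ε κ B M : ℝ} {U u w : Fin 2 → ℝ × ℝ → ℝ} {P : ℝ × ℝ → ℝ}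
  {V V' W G : Fin 2 → Fin 2 → ℝ × ℝ → ℝ}

lemma memLp_symGrad (hW : ∀ i j, MemLp (W i j) 2 (vol (strip ε))) (i j : Fin 2) :
    MemLp (symGrad W i j) 2 (vol (strip ε)) := by
  convert ((hW i j).add (hW j i)).const_mul (1 / 2) using 1
  funext x
  simp only [symGrad, Pi.add_apply]
  ring

/-- The square of the `L²(D_ε)` norm of a gradient. -/
def dirichlet (ε : ℝ) (W : Fin 2 → Fin 2 → ℝ × ℝ → ℝ) : ℝ :=
  ∑ i, ∑ j, ∫ x, W i j x ^ 2 ∂vol (strip ε)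

/-- The bilinear form `∫ ν 𝒟v : 𝒟w` of the Stokes problem, as a function of the gradients of `v`
and `w`. -/
def viscousForm (ν : ℝ → ℝ) (ε : ℝ) (V W : Fin 2 → Fin 2 → ℝ × ℝ → ℝ) : ℝ :=
  ∫ x, ν x.1 * ∑ i, ∑ j, symGrad V i j x * symGrad W i j x ∂vol (strip ε)

lemma dirichlet_nonneg (W : Fin 2 → Fin 2 → ℝ × ℝ → ℝ) : 0 ≤ dirichlet ε W :=
  Finset.sum_nonneg fun _ _ => Finset.sum_nonneg fun _ _ => integral_nonneg fun _ => sq_nonneg _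

lemma integral_sq_le_dirichlet (W : Fin 2 → Fin 2 → ℝ × ℝ → ℝ) (i j : Fin 2) :
    ∫ x, W i j x ^ 2 ∂vol (strip ε) ≤ dirichlet ε W := by
  have h (i j) : 0 ≤ ∫ x, W i j x ^ 2 ∂vol (strip ε) := integral_nonneg fun _ => sq_nonneg _
  exact (Finset.single_le_sum (fun j _ => h i j) (Finset.mem_univ j)).trans
    (Finset.single_le_sum (f := fun i => ∑ j, ∫ x, W i j x ^ 2 ∂vol (strip ε))
      (fun i _ => Finset.sum_nonneg fun j _ => h i j) (Finset.mem_univ i))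

lemma dirichlet_eq_integral (hW : ∀ i j, MemLp (W i j) 2 (vol (strip ε))) :
    dirichlet ε W = ∫ x, ∑ i, ∑ j, W i j x ^ 2 ∂vol (strip ε) := by
  have hi (i j) := (hW i j).integrable_sq
  rw [integral_finsetSum _ fun i _ => integrable_finsetSum _ fun j _ => hi i j]
  exact Finset.sum_congr rfl fun i _ => (integral_finsetSum _ fun j _ => hi i j).symm

lemma integrable_mul_sum_symGrad (hν : Continuous ν)
    (hV : ∀ i j, MemLp (V i j) 2 (vol (strip ε))) (hW : ∀ i j, MemLp (W i j) 2 (vol (strip ε))) :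
    Integrable (fun x => ν x.1 * ∑ i, ∑ j, symGrad V i j x * symGrad W i j x) (vol (strip ε)) := by
  simp_rw [Finset.mul_sum, ← mul_assoc]
  exact integrable_finsetSum _ fun i _ => integrable_finsetSum _ fun j _ =>
    integrable_mul_of_memLp (memLp_mul_of_continuous (hν.comp continuous_fst)
      (memLp_symGrad hV i j)) (memLp_symGrad hW i j)

lemma viscousForm_eq_sum (hν : Continuous ν) (hV : ∀ i j, MemLp (V i j) 2 (vol (strip ε)))
    (hW : ∀ i j, MemLp (W i j) 2 (vol (strip ε))) :
    viscousForm ν ε V W =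
      ∑ i, ∑ j, ∫ x, ν x.1 * symGrad V i j x * W i j x ∂vol (strip ε) := by
  have hi (i j) : Integrable (fun x => ν x.1 * symGrad V i j x * W i j x) (vol (strip ε)) :=
    integrable_mul_of_memLp (memLp_mul_of_continuous (hν.comp continuous_fst)
      (memLp_symGrad hV i j)) (hW i j)
  simp_rw [← integral_finsetSum Finset.univ fun j _ => hi _ j]
  rw [← integral_finsetSum Finset.univ fun i _ => integrable_finsetSum _ fun j _ => hi i j]
  refine integral_congr_ae (.of_forall fun x => ?_)
  simp only [symGrad, Fin.sum_univ_two]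
  ring

lemma viscousForm_sub_left (hν : Continuous ν) (hV : ∀ i j, MemLp (V i j) 2 (vol (strip ε)))
    (hV' : ∀ i j, MemLp (V' i j) 2 (vol (strip ε))) (hW : ∀ i j, MemLp (W i j) 2 (vol (strip ε))) :
    viscousForm ν ε (fun i j => V i j - V' i j) W =
      viscousForm ν ε V W - viscousForm ν ε V' W := by
  simp only [viscousForm]
  rw [← integral_sub (integrable_mul_sum_symGrad hν hV hW) (integrable_mul_sum_symGrad hν hV' hW)]
  refine integral_congr_ae (.of_forall fun x => ?_)
  simp only [symGrad, Fin.sum_univ_two, Pi.sub_apply]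
  ring

lemma sqrt_integral_sq_mul_le {f g : ℝ × ℝ → ℝ} (hB : 0 ≤ B) (hf : Continuous f)
    (h : ∀ x ∈ (strip ε : Set (ℝ × ℝ)), |f x| ≤ B) (hg : MemLp g 2 (vol (strip ε))) :
    √(∫ x, (f x * g x) ^ 2 ∂vol (strip ε)) ≤ B * √(∫ x, g x ^ 2 ∂vol (strip ε)) := by
  rw [← Real.sqrt_sq hB, ← Real.sqrt_mul (sq_nonneg B), ← integral_const_mul]
  refine Real.sqrt_le_sqrt (integral_mono_ae (memLp_mul_of_continuous hf hg).integrable_sq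
    (hg.integrable_sq.const_mul _) (ae_vol_strip fun x hx => ?_))
  simp only [mul_pow]
  exact mul_le_mul_of_nonneg_right (sq_le_sq' (abs_le.1 (h x hx)).1 (abs_le.1 (h x hx)).2)
    (sq_nonneg _)

lemma sqrt_integral_symGrad_sq_le (hW : ∀ i j, MemLp (W i j) 2 (vol (strip ε))) (i j : Fin 2) :
    √(∫ x, symGrad W i j x ^ 2 ∂vol (strip ε)) ≤ √(dirichlet ε W) := by
  refine Real.sqrt_le_sqrt ?_
  have hi := (hW i j).integrable_sq.const_mul (1 / 2)
  have hj := (hW j i).integrable_sq.const_mul (1 / 2)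
  have hle : ∫ x, symGrad W i j x ^ 2 ∂vol (strip ε) ≤
      ∫ x, (1 / 2 * W i j x ^ 2 + 1 / 2 * W j i x ^ 2) ∂vol (strip ε) := by
    refine integral_mono (memLp_symGrad hW i j).integrable_sq (hi.add hj) fun x => ?_
    simp only [symGrad]
    nlinarith [sq_nonneg (W i j x - W j i x)]
  rw [integral_add hi hj, integral_const_mul, integral_const_mul] at hle
  linarith [integral_sq_le_dirichlet (ε := ε) W i j, integral_sq_le_dirichlet (ε := ε) W j i]

lemma abs_viscousForm_le (hM : 0 ≤ M) (hν : Continuous ν)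
    (hν_le : ∀ s ∈ Ioo (0 : ℝ) 1, |ν s| ≤ M) (hV : ∀ i j, MemLp (V i j) 2 (vol (strip ε)))
    (hW : ∀ i j, MemLp (W i j) 2 (vol (strip ε))) :
    |viscousForm ν ε V W| ≤ 4 * (M * √(dirichlet ε V) * √(dirichlet ε W)) := by
  have hνc : Continuous fun x : ℝ × ℝ => ν x.1 := hν.comp continuous_fst
  have hentry (i j) : |∫ x, ν x.1 * symGrad V i j x * W i j x ∂vol (strip ε)| ≤
      M * √(dirichlet ε V) * √(dirichlet ε W) := calc
    _ ≤ √(∫ x, (ν x.1 * symGrad V i j x) ^ 2 ∂vol (strip ε)) *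
        √(∫ x, W i j x ^ 2 ∂vol (strip ε)) :=
      abs_integral_mul_le (memLp_mul_of_continuous hνc (memLp_symGrad hV i j)) (hW i j)
    _ ≤ M * √(∫ x, symGrad V i j x ^ 2 ∂vol (strip ε)) *
        √(∫ x, W i j x ^ 2 ∂vol (strip ε)) := by
      gcongr
      exact sqrt_integral_sq_mul_le hM hνc (fun x hx => hν_le _ hx.1) (memLp_symGrad hV i j)
    _ ≤ _ := mul_le_mul (mul_le_mul_of_nonneg_left (sqrt_integral_symGrad_sq_le hV i j) hM)
      (Real.sqrt_le_sqrt (integral_sq_le_dirichlet W i j)) (Real.sqrt_nonneg _) (by positivity)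
  rw [viscousForm_eq_sum hν hV hW]
  calc _ ≤ ∑ i, ∑ j, |∫ x, ν x.1 * symGrad V i j x * W i j x ∂vol (strip ε)| :=
        (Finset.abs_sum_le_sum_abs _ _).trans
          (Finset.sum_le_sum fun _ _ => Finset.abs_sum_le_sum_abs _ _)
    _ ≤ ∑ _ : Fin 2, ∑ _ : Fin 2, M * √(dirichlet ε V) * √(dirichlet ε W) :=
        Finset.sum_le_sum fun i _ => Finset.sum_le_sum fun j _ => hentry i j
    _ = 4 * (M * √(dirichlet ε V) * √(dirichlet ε W)) := by
        simp only [Fin.sum_univ_two]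
        ring

/-- The Korn inequality: `2 |𝒟w|² = |∇w|² + (div w)² + 2 (∂₁w₀ ∂₀w₁ - ∂₀w₀ ∂₁w₁)`, and the last
term is a null Lagrangian. -/
lemma mul_dirichlet_le_viscousForm (hε : 0 < ε) (hκ : 0 ≤ κ) (hν : Continuous ν)
    (hν_ge : ∀ s ∈ Ioo (0 : ℝ) 1, κ ≤ ν s) (h : ∀ i, MemHPer10 ε (w i) (W i)) :
    κ * dirichlet ε W ≤ 2 * viscousForm ν ε W W := by
  have hW (i j) : MemLp (W i j) 2 (vol (strip ε)) := (h i).memLp_grad j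
  have hsq : Integrable (fun x => ∑ i, ∑ j, W i j x ^ 2) (vol (strip ε)) :=
    integrable_finsetSum _ fun i _ => integrable_finsetSum _ fun j _ => (hW i j).integrable_sq
  have hoff := integrable_mul_of_memLp (hW 0 1) (hW 1 0)
  have hdiag := integrable_mul_of_memLp (hW 0 0) (hW 1 1)
  have hnull : dirichlet ε W = ∫ x, (∑ i, ∑ j, W i j x ^ 2 +
      2 * (W 0 1 x * W 1 0 x - W 0 0 x * W 1 1 x)) ∂vol (strip ε) := by
    rw [integral_add hsq ((hoff.sub' hdiag).const_mul 2), integral_const_mul,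
      integral_sub hoff hdiag, (h 0).integral_mul_comm hε (h 1), sub_self, mul_zero, add_zero,
      dirichlet_eq_integral hW]
  rw [hnull, viscousForm, ← integral_const_mul, ← integral_const_mul]
  refine integral_mono_ae ((hsq.add ((hoff.sub' hdiag).const_mul 2)).const_mul κ)
    ((integrable_mul_sum_symGrad hν hW hW).const_mul 2) (ae_vol_strip fun x hx => ?_)
  have hpos : 0 ≤ ∑ i, ∑ j, symGrad W i j x * symGrad W i j x :=
    Finset.sum_nonneg fun _ _ => Finset.sum_nonneg fun _ _ => mul_self_nonneg _
  calc κ * (∑ i, ∑ j, W i j x ^ 2 + 2 * (W 0 1 x * W 1 0 x - W 0 0 x * W 1 1 x))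
      ≤ κ * (2 * ∑ i, ∑ j, symGrad W i j x * symGrad W i j x) := by
        refine mul_le_mul_of_nonneg_left ?_ hκ
        simp only [symGrad, Fin.sum_univ_two]
        linarith [sq_nonneg (W 0 0 x + W 1 1 x)]
    _ ≤ 2 * (ν x.1 * ∑ i, ∑ j, symGrad W i j x * symGrad W i j x) := by
        linarith [mul_le_mul_of_nonneg_right (hν_ge x.1 hx.1) hpos]

/-- The gradient of a classical vector field. -/
def jac (U : Fin 2 → ℝ × ℝ → ℝ) (i j : Fin 2) : ℝ × ℝ → ℝ := pd j (U i)

/-- The viscous stress `ν 𝒟U` of a classical vector field. -/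
def stress (ν : ℝ → ℝ) (U : Fin 2 → ℝ × ℝ → ℝ) (i j : Fin 2) (x : ℝ × ℝ) : ℝ :=
  ν x.1 * symGrad (jac U) i j x

/-- The residual `-div (ν 𝒟U) + ∇P - f₁ e₁` of the momentum equation. -/
def residual (ν f₁ : ℝ → ℝ) (U : Fin 2 → ℝ × ℝ → ℝ) (P : ℝ × ℝ → ℝ) (i : Fin 2) (x : ℝ × ℝ) : ℝ :=
  -(∑ j, pd j (stress ν U i j) x) + pd i P x - force f₁ i x

/-- An approximate solution of the Stokes problem: a classical velocity in `H_per(D_ε)` with a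
classical pressure, for which `residual` is meaningful. The momentum equation is not imposed. -/
structure IsClassicalPair (ε : ℝ) (U : Fin 2 → ℝ × ℝ → ℝ) (P : ℝ × ℝ → ℝ) : Prop where
  smooth : ∀ i, ContDiff ℝ 2 (U i)
  smooth_pressure : ContDiff ℝ 1 P
  periodic : ∀ i s, ∀ t ∈ Icc (-(ε / 2)) (ε / 2), U i (s + 1, t) = U i (s, t)
  sides : ∀ t ∈ Ioo (-(ε / 2)) (ε / 2), P (1, t) = P (0, t)
  top : ∀ i s, U i (s, ε / 2) = 0
  bot : ∀ i s, U i (s, -(ε / 2)) = 0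
  div_free : ∀ x ∈ (strip ε : Set (ℝ × ℝ)), pd 0 (U 0) x + pd 1 (U 1) x = 0

lemma continuous_force (hf : Continuous f₁) (i : Fin 2) : Continuous (force f₁ i) := by
  fin_cases i
  · exact hf.comp continuous_fst
  · exact continuous_const

lemma contDiff_jac (hU : ∀ i, ContDiff ℝ 2 (U i)) (i j : Fin 2) : ContDiff ℝ 1 (jac U i j) :=
  contDiff_pd (hU i) (by norm_num) j

lemma contDiff_stress (hν : ContDiff ℝ 1 ν) (hU : ∀ i, ContDiff ℝ 2 (U i)) (i j : Fin 2) :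
    ContDiff ℝ 1 (stress ν U i j) :=
  (hν.comp contDiff_fst).mul (((contDiff_jac hU i j).add (contDiff_jac hU j i)).div_const 2)

lemma continuous_residual (hν : ContDiff ℝ 1 ν) (hf : Continuous f₁) (h : IsClassicalPair ε U P)
    (i : Fin 2) : Continuous (residual ν f₁ U P i) :=
  ((continuous_finsetSum _ fun j _ => continuous_pd (contDiff_stress hν h.smooth i j) j).neg.add
    (continuous_pd h.smooth_pressure i)).sub (continuous_force hf i)

lemma IsClassicalPair.memLp_jac (h : IsClassicalPair ε U P) (i j : Fin 2) :
    MemLp (jac U i j) 2 (vol (strip ε)) :=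
  memLp_of_continuous (contDiff_jac h.smooth i j).continuous

lemma IsClassicalPair.memHPer (hε : 0 < ε) (h : IsClassicalPair ε U P) :
    MemHPer ε U (jac U) where
  comp i :=
    memHPer10_of_contDiff hε ((h.smooth i).of_le (by norm_num)) (h.periodic i) (h.top i) (h.bot i)
  div_free := ae_vol_strip h.div_free

lemma MemHPer.sub (h : MemHPer ε U V) (h' : MemHPer ε u G) :
    MemHPer ε (fun i => U i - u i) (fun i j => V i j - G i j) where
  comp i := (h.comp i).sub (h'.comp i)
  div_free := by
    filter_upwards [h.div_free, h'.div_free] with x hV hG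
    simp only [Pi.sub_apply]
    linarith

lemma IsClassicalPair.stress_sides (hν : Function.Periodic ν 1) (h : IsClassicalPair ε U P)
    (i j : Fin 2) {t : ℝ} (ht : t ∈ Ioo (-(ε / 2)) (ε / 2)) :
    stress ν U i j (1, t) = stress ν U i j (0, t) := by
  have hjac (i j) : jac U i j (1, t) = jac U i j (0, t) := by
    simpa [jac] using pd_periodic (Icc_mem_nhds ht.1 ht.2) (h.periodic i) j 0
  have hν₁ : ν 1 = ν 0 := by simpa using hν 0
  simp only [stress, symGrad, hjac, hν₁]

lemma IsClassicalPair.weak_form_comp (hν : ContDiff ℝ 1 ν) (hν_per : Function.Periodic ν 1)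
    (hf : Continuous f₁) (h : IsClassicalPair ε U P) {w : ℝ × ℝ → ℝ} {g : Fin 2 → ℝ × ℝ → ℝ}
    (hw : MemLp w 2 (vol (strip ε))) (hibp : IntegratesByParts ε w g) (i : Fin 2) :
    (∑ j, ∫ x, stress ν U i j x * g j x ∂vol (strip ε)) - ∫ x, P x * g i x ∂vol (strip ε) =
      (∫ x, residual ν f₁ U P i x * w x ∂vol (strip ε)) +
        ∫ x, force f₁ i x * w x ∂vol (strip ε) := by
  have hint {b : ℝ × ℝ → ℝ} (hb : Continuous b) : Integrable (fun x => b x * w x) (vol (strip ε)) :=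
    integrable_mul_of_memLp (memLp_of_continuous hb) hw
  have hs (j) := contDiff_stress hν h.smooth i j
  have hdiv (j) := hint (continuous_pd (hs j) j)
  rw [hibp P h.smooth_pressure h.sides i]
  simp_rw [fun j => hibp _ (hs j) (fun _ ht => h.stress_sides hν_per i j ht) j]
  rw [← integral_add (hint (continuous_residual hν hf h i)) (hint (continuous_force hf i)),
    Fin.sum_univ_two, sub_neg_eq_add, ← neg_add, ← integral_add (hdiv 0) (hdiv 1),
    ← integral_neg, ← integral_add ((hdiv 0).fun_add (hdiv 1)).fun_neg
      (hint (continuous_pd h.smooth_pressure i))]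
  refine integral_congr_ae (.of_forall fun x => ?_)
  simp only [residual, Fin.sum_univ_two]
  ring

lemma IsClassicalPair.weak_form (hν : ContDiff ℝ 1 ν) (hν_per : Function.Periodic ν 1)
    (hf : Continuous f₁) (h : IsClassicalPair ε U P) (hw : ∀ i, MemLp (w i) 2 (vol (strip ε)))
    (hW : ∀ i j, MemLp (W i j) 2 (vol (strip ε)))
    (hibp : ∀ i, IntegratesByParts ε (w i) (W i)) :
    viscousForm ν ε (jac U) W - ∑ i, ∫ x, P x * W i i x ∂vol (strip ε) =
      (∑ i, ∫ x, residual ν f₁ U P i x * w i x ∂vol (strip ε)) +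
        ∑ i, ∫ x, force f₁ i x * w i x ∂vol (strip ε) := by
  rw [viscousForm_eq_sum hν.continuous h.memLp_jac hW, ← Finset.sum_sub_distrib,
    ← Finset.sum_add_distrib]
  exact Finset.sum_congr rfl fun i _ => h.weak_form_comp hν hν_per hf (hw i) (hibp i) i

lemma MemHPer.sum_integral_pressure_mul (hP : Continuous P) (h : MemHPer ε w W) :
    ∑ i, ∫ x, P x * W i i x ∂vol (strip ε) = 0 := by
  have hint (i) := integrable_mul_of_memLp (memLp_of_continuous hP) ((h.comp i).memLp_grad i)
  rw [Fin.sum_univ_two, ← integral_add (hint 0) (hint 1)]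
  refine integral_eq_zero_of_ae ?_
  filter_upwards [h.div_free] with x hx
  rw [← mul_add, hx, mul_zero, Pi.zero_apply]

lemma IsWeakSolution.viscousForm_error_eq (hε : 0 < ε) (hν : ContDiff ℝ 1 ν)
    (hν_per : Function.Periodic ν 1) (hf : Continuous f₁) (h : IsClassicalPair ε U P)
    (hu : IsWeakSolution ν f₁ ε u G) (hw : MemHPer ε w W) :
    viscousForm ν ε (fun i j => jac U i j - G i j) W =
      ∑ i, ∫ x, residual ν f₁ U P i x * w i x ∂vol (strip ε) := by
  have hW (i j) := (hw.comp i).memLp_grad j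
  have hclassical := h.weak_form hν hν_per hf (fun i => (hw.comp i).memLp) hW
    (fun i => (hw.comp i).integratesByParts hε)
  have hweak : viscousForm ν ε G W = ∑ i, ∫ x, force f₁ i x * w i x ∂vol (strip ε) :=
    (hu.weak w W hw).trans (integral_finsetSum _ fun i _ =>
      integrable_mul_of_memLp (memLp_of_continuous (continuous_force hf i)) (hw.comp i).memLp)
  rw [hw.sum_integral_pressure_mul h.smooth_pressure.continuous] at hclassical
  rw [viscousForm_sub_left hν.continuous h.memLp_jac (fun i j => (hu.mem.comp i).memLp_grad j) hW]
  linarith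

/-- The Poincaré inequality gains a factor `ε`, and the area of the strip a factor `√ε`. -/
lemma abs_sum_integral_mul_le {f : Fin 2 → ℝ × ℝ → ℝ} (hB : 0 ≤ B) (hε : 0 < ε)
    (hf : ∀ i, Continuous (f i)) (hfB : ∀ i, ∀ x ∈ (strip ε : Set (ℝ × ℝ)), |f i x| ≤ B)
    (hw : ∀ i, MemLp (w i) 2 (vol (strip ε)))
    (hwW : ∀ i, ∫ x, w i x ^ 2 ∂vol (strip ε) ≤ ε ^ 2 * ∫ x, W i 1 x ^ 2 ∂vol (strip ε)) :
    |∑ i, ∫ x, f i x * w i x ∂vol (strip ε)| ≤ 2 * (B * (ε * √ε)) * √(dirichlet ε W) := by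
  have hforce (i) : √(∫ x, f i x ^ 2 ∂vol (strip ε)) ≤ B * √ε := by
    simpa [Measure.real, volume_strip, hε.le] using
      sqrt_integral_sq_mul_le hB (hf i) (hfB i) (memLp_const 1)
  have hvel (i) : √(∫ x, w i x ^ 2 ∂vol (strip ε)) ≤ ε * √(dirichlet ε W) := by
    rw [← Real.sqrt_sq hε.le, ← Real.sqrt_mul (sq_nonneg ε), Real.sqrt_sq hε.le]
    exact Real.sqrt_le_sqrt ((hwW i).trans (by gcongr; exact integral_sq_le_dirichlet W i 1))
  have hcomp (i) : |∫ x, f i x * w i x ∂vol (strip ε)| ≤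
      (B * √ε) * (ε * √(dirichlet ε W)) :=
    (abs_integral_mul_le (memLp_of_continuous (hf i)) (hw i)).trans
      (by gcongr; exacts [hforce i, hvel i])
  rw [Fin.sum_univ_two]
  linarith [abs_add_le (∫ x, f 0 x * w 0 x ∂vol (strip ε)) (∫ x, f 1 x * w 1 x ∂vol (strip ε)),
    hcomp 0, hcomp 1]

theorem IsWeakSolution.sqrt_dirichlet_error_le (hκ : 0 < κ) (hB : 0 ≤ B) (hε : 0 < ε)
    (hν : ContDiff ℝ 1 ν) (hν_per : Function.Periodic ν 1)
    (hν_ge : ∀ s ∈ Ioo (0 : ℝ) 1, κ ≤ ν s) (hf : Continuous f₁) (h : IsClassicalPair ε U P)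
    (hres : ∀ i, ∀ x ∈ (strip ε : Set (ℝ × ℝ)), |residual ν f₁ U P i x| ≤ B)
    (hu : IsWeakSolution ν f₁ ε u G) :
    √(dirichlet ε (fun i j => jac U i j - G i j)) ≤ 4 / κ * (B * (ε * √ε)) := by
  have herr := (h.memHPer hε).sub hu.mem
  have hkorn := mul_dirichlet_le_viscousForm hε hκ.le hν.continuous hν_ge herr.comp
  rw [hu.viscousForm_error_eq hε hν hν_per hf h herr] at hkorn
  have hres := abs_sum_integral_mul_le hB hε (continuous_residual hν hf h) hres
    (fun i => (herr.comp i).memLp) (fun i => (herr.comp i).integral_sq_le hε)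
  set E := dirichlet ε (fun i j => jac U i j - G i j)
  have hle : κ * √E * √E ≤ 4 * (B * (ε * √ε)) * √E := by
    rw [mul_assoc, Real.mul_self_sqrt (dirichlet_nonneg _)]
    linarith [(abs_le.1 hres).2]
  rcases (Real.sqrt_nonneg E).eq_or_lt with h0 | h0
  · rw [← h0]
    positivity
  · rw [div_mul_eq_mul_div, le_div_iff₀' hκ]
    exact le_of_mul_le_mul_right hle h0

theorem h1Norm_le (hε : 0 < ε) (hε1 : ε ≤ 1) (h : ∀ i, MemHPer10 ε (w i) (W i)) :
    h1Norm (strip ε) w ≤ ENNReal.ofReal (2 * √(dirichlet ε W)) := by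
  have hnonneg (f : ℝ × ℝ → ℝ) : 0 ≤ ∫ x, f x ^ 2 ∂vol (strip ε) :=
    integral_nonneg fun _ => sq_nonneg _
  have hpoincare (i) : ∫ x, w i x ^ 2 ∂vol (strip ε) ≤ ∑ j, ∫ x, W i j x ^ 2 ∂vol (strip ε) :=
    calc _ ≤ ε ^ 2 * ∫ x, W i 1 x ^ 2 ∂vol (strip ε) := (h i).integral_sq_le hε
      _ ≤ ∫ x, W i 1 x ^ 2 ∂vol (strip ε) :=
        mul_le_of_le_one_left (hnonneg _) (pow_le_one₀ hε.le hε1)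
      _ ≤ _ := Finset.single_le_sum (fun j _ => hnonneg (W i j)) (Finset.mem_univ 1)
  have hsum : ∑ i, (eLpNorm (w i) 2 (vol (strip ε)) ^ 2 +
      ∑ j, eLpNorm (W i j) 2 (vol (strip ε)) ^ 2) ≤ ENNReal.ofReal (2 ^ 2 * dirichlet ε W) := by
    have hgrad (i) := Finset.sum_nonneg fun j (_ : j ∈ Finset.univ) => hnonneg (W i j)
    have hcomp (i) : eLpNorm (w i) 2 (vol (strip ε)) ^ 2 +
        ∑ j, eLpNorm (W i j) 2 (vol (strip ε)) ^ 2 = ENNReal.ofReal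
          ((∫ x, w i x ^ 2 ∂vol (strip ε)) + ∑ j, ∫ x, W i j x ^ 2 ∂vol (strip ε)) := by
      rw [ENNReal.ofReal_add (hnonneg _) (hgrad i),
        ENNReal.ofReal_sum_of_nonneg fun j _ => hnonneg (W i j), eLpNorm_two_sq (h i).memLp]
      simp_rw [fun j => eLpNorm_two_sq ((h i).memLp_grad j)]
    rw [Finset.sum_congr rfl fun i _ => hcomp i,
      ← ENNReal.ofReal_sum_of_nonneg fun i _ => add_nonneg (hnonneg (w i)) (hgrad i),
      Finset.sum_add_distrib]
    refine ENNReal.ofReal_le_ofReal ?_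
    have hle : ∑ i, ∫ x, w i x ^ 2 ∂vol (strip ε) ≤ dirichlet ε W :=
      Finset.sum_le_sum fun i _ => hpoincare i
    change _ + dirichlet ε W ≤ _
    linarith [dirichlet_nonneg (ε := ε) W]
  calc h1Norm (strip ε) w ≤ _ := iInf₂_le W fun i => (h i).hasWeakGrad hε
    _ ≤ ENNReal.ofReal (2 ^ 2 * dirichlet ε W) ^ (1 / 2 : ℝ) :=
      ENNReal.rpow_le_rpow hsum (by norm_num)
    _ = ENNReal.ofReal (2 * √(dirichlet ε W)) := by
      rw [ENNReal.ofReal_rpow_of_nonneg (mul_nonneg (sq_nonneg _) (dirichlet_nonneg W))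
        (by norm_num), ← Real.sqrt_eq_rpow, Real.sqrt_mul (sq_nonneg _),
        Real.sqrt_sq zero_le_two]

lemma lineDerivOp_testFunction_apply (φ : 𝓓(strip ε, ℝ)) (i : Fin 2) (x : ℝ × ℝ) :
    (∂_{dir i} φ : 𝓓(strip ε, ℝ)) x = pd i φ x := by
  rw [TestFunction.lineDerivOp_eq_lineDerivCLM ℝ, TestFunction.lineDerivCLM_apply_of_le (by simp)]
  exact ((isStripTest_testFunction φ).smooth.differentiable one_ne_zero x).lineDeriv_eq_fderiv

lemma funDistribution_apply {g : ℝ × ℝ → ℝ} (hg : Continuous g) (φ : 𝓓(strip ε, ℝ)) :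
    funDistribution (strip ε) g φ = ∫ x, g x * φ x ∂vol (strip ε) := by
  have hglobal : funDistribution (strip ε) g φ = ∫ x, φ x * g x :=
    TestFunction.integralAgainstBilinCLM_eq_integral (hg.locallyIntegrable.locallyIntegrableOn _)
  rw [hglobal, setIntegral_eq_integral_of_forall_compl_eq_zero]
  · simp_rw [mul_comm]
  · intro x hx
    rw [testFunction_eq_zero φ hx, mul_zero]

lemma grad_funDistribution_apply {g : ℝ × ℝ → ℝ} (hg : Continuous g) (i : Fin 2)
    (φ : 𝓓(strip ε, ℝ)) :
    grad (funDistribution (strip ε) g) i φ = -∫ x, g x * pd i φ x ∂vol (strip ε) := by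
  change -funDistribution (strip ε) g (∂_{dir i} φ) = _
  rw [funDistribution_apply hg]
  simp_rw [lineDerivOp_testFunction_apply]

lemma IsPressure.sum_grad_sub_apply (hν : ContDiff ℝ 1 ν) (hν_per : Function.Periodic ν 1)
    (hf : Continuous f₁) (hε : 0 < ε) (h : IsClassicalPair ε U P)
    (hG : ∀ i j, MemLp (G i j) 2 (vol (strip ε))) {p : 𝓓'(strip ε, ℝ)}
    (hp : IsPressure ν f₁ ε G p) (φ : Fin 2 → 𝓓(strip ε, ℝ)) :
    ∑ i, (grad (funDistribution (strip ε) P) i - grad p i) (φ i) =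
      (∑ i, ∫ x, residual ν f₁ U P i x * φ i x ∂vol (strip ε)) -
        viscousForm ν ε (fun i j => jac U i j - G i j) (jac fun i => φ i) := by
  have hφ (i) := isStripTest_testFunction (φ i)
  have hφ₁ (i j) : MemLp (jac (fun i => φ i) i j) 2 (vol (strip ε)) :=
    memLp_of_continuous (continuous_pd (hφ i).smooth j)
  have hclassical := h.weak_form hν hν_per hf
    (fun i => memLp_of_continuous (hφ i).smooth.continuous) hφ₁
    (fun i => (hφ i).integratesByParts hε)
  have hpress : viscousForm ν ε G (jac fun i => φ i) + ∑ i, grad p i (φ i) =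
      ∑ i, ∫ x, force f₁ i x * φ i x ∂vol (strip ε) := by
    rw [viscousForm_eq_sum hν.continuous hG hφ₁, ← Finset.sum_add_distrib]
    exact Finset.sum_congr rfl fun i _ => hp i (φ i)
  have hgrad : ∑ i, grad (funDistribution (strip ε) P) i (φ i) =
      -∑ i, ∫ x, P x * jac (fun i => φ i) i i x ∂vol (strip ε) := by
    simp_rw [grad_funDistribution_apply h.smooth_pressure.continuous, Finset.sum_neg_distrib, jac]
  have hsub : ∑ i, (grad (funDistribution (strip ε) P) i - grad p i) (φ i) =
      ∑ i, grad (funDistribution (strip ε) P) i (φ i) - ∑ i, grad p i (φ i) :=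
    Finset.sum_sub_distrib ..
  rw [hsub, hgrad, viscousForm_sub_left hν.continuous h.memLp_jac hG hφ₁]
  linarith

theorem IsPressure.hMinusOneNorm_error_le (hB : 0 ≤ B) (hM : 0 ≤ M) (hε : 0 < ε)
    (hν : ContDiff ℝ 1 ν) (hν_per : Function.Periodic ν 1)
    (hν_le : ∀ s ∈ Ioo (0 : ℝ) 1, |ν s| ≤ M) (hf : Continuous f₁) (h : IsClassicalPair ε U P)
    (hres : ∀ i, ∀ x ∈ (strip ε : Set (ℝ × ℝ)), |residual ν f₁ U P i x| ≤ B)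
    (hG : ∀ i j, MemLp (G i j) 2 (vol (strip ε))) {p : 𝓓'(strip ε, ℝ)}
    (hp : IsPressure ν f₁ ε G p) :
    hMinusOneNorm (strip ε) (fun i => grad (funDistribution (strip ε) P) i - grad p i) ≤
      ENNReal.ofReal (2 * (B * (ε * √ε)) +
        4 * (M * √(dirichlet ε (fun i j => jac U i j - G i j)))) := by
  refine iSup₂_le fun φ hφ => ENNReal.ofReal_le_ofReal ?_
  have hφ₀ (i) := isStripTest_testFunction (φ i)
  have hone : √(dirichlet ε (jac fun i => φ i)) ≤ 1 := Real.sqrt_le_one.2 hφ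
  have hresidual := abs_sum_integral_mul_le (W := jac fun i => φ i) hB hε
    (continuous_residual hν hf h) hres (fun i => memLp_of_continuous (hφ₀ i).smooth.continuous)
    (fun i => (hφ₀ i).integral_sq_le hε)
  have hviscous := abs_viscousForm_le (V := fun i j => jac U i j - G i j)
    (W := jac fun i => φ i) hM hν.continuous hν_le (fun i j => (h.memLp_jac i j).sub (hG i j))
    (fun i j => memLp_of_continuous (continuous_pd (hφ₀ i).smooth j))
  rw [hp.sum_grad_sub_apply hν hν_per hf hε h hG φ]
  refine (abs_sub _ _).trans (add_le_add ?_ ?_)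
  · exact hresidual.trans (mul_le_of_le_one_right (by positivity) hone)
  · exact hviscous.trans (mul_le_mul_of_nonneg_left
      (mul_le_of_le_one_right (by positivity) hone) zero_le_four)

end Energy

/-! ### The residual of the ansatz -/

section Ansatz

variable {ν f₁ : ℝ → ℝ} {ε κ : ℝ} {j k m n : ℕ} {a : Coeffs} {w : ℕ → ℝ × ℝ → ℝ}
  {v : ℝ × ℝ → ℝ} {x y : ℝ × ℝ} {r : WithTop ℕ∞}

/-- The change of variables `x ↦ (x₁, x₂ / ε)` from the thin strip to the strip of unit height. -/
def dilate (ε : ℝ) (x : ℝ × ℝ) : ℝ × ℝ := (x.1, x.2 / ε)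

/-- The partial sum `∑_{j < n} ε^{j + m} w_j(x₁, x₂ / ε)` of an asymptotic series. -/
def series (ε : ℝ) (n m : ℕ) (w : ℕ → ℝ × ℝ → ℝ) (x : ℝ × ℝ) : ℝ :=
  ∑ j ∈ Finset.range n, ε ^ (j + m) * w j (dilate ε x)

/-- The terms of `series ε n m w` which are of order at least `ε ^ n`. -/
def remainder (ε : ℝ) (n m : ℕ) (w : ℕ → ℝ × ℝ → ℝ) (x : ℝ × ℝ) : ℝ :=
  ∑ j ∈ Finset.Ico (n - m) n, ε ^ (j + m) * w j (dilate ε x)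

/-- The weighted derivative `ν(x₁) ∂ᵢv` from which the stress is built. -/
def flux (ν : ℝ → ℝ) (i : Fin 2) (v : ℝ × ℝ → ℝ) (x : ℝ × ℝ) : ℝ := ν x.1 * pd i v x

lemma contDiff_dilate : ContDiff ℝ r (dilate ε) :=
  contDiff_fst.prodMk (contDiff_snd.div_const ε)

lemma dilate_snd_mem_Icc (hε : 0 < ε) (hx : x.2 ∈ Icc (-(ε / 2)) (ε / 2)) :
    (dilate ε x).2 ∈ Icc (-(1 / 2) : ℝ) (1 / 2) := by
  change x.2 / ε ∈ _
  constructor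
  · rw [le_div_iff₀ hε]
    linarith [hx.1]
  · rw [div_le_iff₀ hε]
    linarith [hx.2]

lemma dilate_snd_mem_Ioo (hε : 0 < ε) (hx : x.2 ∈ Ioo (-(ε / 2)) (ε / 2)) :
    (dilate ε x).2 ∈ Ioo (-(1 / 2) : ℝ) (1 / 2) := by
  change x.2 / ε ∈ _
  constructor
  · rw [lt_div_iff₀ hε]
    linarith [hx.1]
  · rw [div_lt_iff₀ hε]
    linarith [hx.2]

lemma dilate_top (hε : ε ≠ 0) (s : ℝ) : dilate ε (s, ε / 2) = (s, 1 / 2) := by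
  simp only [dilate, Prod.mk.injEq, true_and]
  field_simp

lemma dilate_bot (hε : ε ≠ 0) (s : ℝ) : dilate ε (s, -(ε / 2)) = (s, -(1 / 2)) := by
  simp only [dilate, Prod.mk.injEq, true_and]
  field_simp

lemma pd_zero_dilate (hv : Differentiable ℝ v) :
    pd 0 (fun y => v (dilate ε y)) x = pd 0 v (dilate ε x) :=
  pd_fst_eq (hv.comp (contDiff_dilate.differentiable one_ne_zero) x)
    (hasDerivAt_fst (x := dilate ε x) (hv _))

lemma pd_one_dilate (hv : Differentiable ℝ v) :
    pd 1 (fun y => v (dilate ε y)) x = ε⁻¹ * pd 1 v (dilate ε x) := by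
  refine pd_snd_eq (hv.comp (contDiff_dilate.differentiable one_ne_zero) x) ?_
  have hdiv := (hasDerivAt_id x.2).div_const ε
  exact ((hasDerivAt_snd (x := dilate ε x) (hv _)).comp x.2 hdiv).congr_deriv
    (by rw [one_div, mul_comm])

lemma contDiff_series (hw : ∀ j < n, ContDiff ℝ r (w j)) : ContDiff ℝ r (series ε n m w) :=
  ContDiff.sum fun j hj => contDiff_const.mul ((hw j (Finset.mem_range.1 hj)).comp contDiff_dilate)

lemma series_congr (h : ∀ j < n, w j (dilate ε x) = w j (dilate ε y)) :
    series ε n m w x = series ε n m w y :=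
  Finset.sum_congr rfl fun j hj => by rw [h j (Finset.mem_range.1 hj)]

lemma series_eq_zero (h : ∀ j < n, w j (dilate ε x) = 0) : series ε n m w x = 0 :=
  Finset.sum_eq_zero fun j hj => by rw [h j (Finset.mem_range.1 hj), mul_zero]

lemma mul_series (g : ℝ → ℝ) :
    g x.1 * series ε n m w x = series ε n m (fun j y => g y.1 * w j y) x := by
  simp only [series, Finset.mul_sum]
  exact Finset.sum_congr rfl fun j _ => mul_left_comm ..

lemma pd_series (hw : ∀ j < n, Differentiable ℝ (w j)) (i : Fin 2) :
    pd i (series ε n m w) x =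
      ∑ j ∈ Finset.range n, ε ^ (j + m) * pd i (fun y => w j (dilate ε y)) x := by
  have hd (j) (hj : j ∈ Finset.range n) : Differentiable ℝ fun y => w j (dilate ε y) :=
    (hw j (Finset.mem_range.1 hj)).comp (contDiff_dilate.differentiable one_ne_zero)
  exact (pd_sum _ fun j hj => (hd j hj x).const_mul _).trans
    (Finset.sum_congr rfl fun j hj => pd_const_mul _ (hd j hj x))

lemma pd_zero_series (hw : ∀ j < n, Differentiable ℝ (w j)) :
    pd 0 (series ε n m w) = series ε n m fun j => pd 0 (w j) := by
  funext x
  rw [pd_series hw]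
  exact Finset.sum_congr rfl fun j hj => by rw [pd_zero_dilate (hw j (Finset.mem_range.1 hj))]

lemma pd_one_series (hε : ε ≠ 0) (hw : ∀ j < n, Differentiable ℝ (w j)) :
    pd 1 (series ε n (m + 1) w) = series ε n m fun j => pd 1 (w j) := by
  funext x
  rw [pd_series hw]
  refine Finset.sum_congr rfl fun j hj => ?_
  rw [pd_one_dilate (hw j (Finset.mem_range.1 hj)), ← add_assoc, pow_succ]
  field_simp

lemma series_back (ε : ℝ) (n m : ℕ) (w : ℕ → ℝ × ℝ → ℝ) (x : ℝ × ℝ) :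
    series ε n 0 (fun j => back w j m) x =
      ∑ j ∈ Finset.range (n - m), ε ^ (j + m) * w j (dilate ε x) := by
  simp only [series, back, add_zero]
  rcases le_total n m with h | h
  · rw [Nat.sub_eq_zero_of_le h, Finset.sum_range_zero]
    refine Finset.sum_eq_zero fun j hj => ?_
    rw [if_neg (by have := Finset.mem_range.1 hj; omega), Pi.zero_apply, mul_zero]
  · obtain ⟨l, rfl⟩ := Nat.exists_eq_add_of_le h
    rw [Finset.sum_range_add, Nat.add_sub_cancel_left, Finset.sum_eq_zero (s := Finset.range m),
      zero_add]
    · refine Finset.sum_congr rfl fun i _ => ?_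
      rw [if_pos (Nat.le_add_right m i), Nat.add_sub_cancel_left, add_comm]
    · intro j hj
      rw [if_neg (Finset.mem_range.1 hj).not_ge, Pi.zero_apply, mul_zero]

lemma series_eq_series_back_add_remainder :
    series ε n m w x = series ε n 0 (fun j => back w j m) x + remainder ε n m w x := by
  rw [series_back]
  exact (Finset.sum_range_add_sum_Ico _ (Nat.sub_le n m)).symm

lemma exists_abs_remainder_le (n m : ℕ) (hw : ∀ j < n, Continuous (w j)) :
    ∃ C, 0 ≤ C ∧ ∀ ε, 0 < ε → ε ≤ 1 → ∀ x ∈ (strip ε : Set (ℝ × ℝ)),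
      |remainder ε n m w x| ≤ C * ε ^ n := by
  have hbound (j) : ∃ C, 0 ≤ C ∧ (j < n → ∀ x ∈ (strip 1 : Set (ℝ × ℝ)), |w j x| ≤ C) := by
    by_cases hj : j < n
    · exact (exists_bound_strip (hw j hj)).imp fun C hC => ⟨hC.1, fun _ => hC.2⟩
    · exact ⟨0, le_rfl, fun h => absurd h hj⟩
  choose C hC₀ hC using hbound
  refine ⟨∑ j ∈ Finset.Ico (n - m) n, C j, Finset.sum_nonneg fun j _ => hC₀ j,
    fun ε hε hε1 x hx => (Finset.abs_sum_le_sum_abs _ _).trans ?_⟩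
  rw [Finset.sum_mul]
  refine Finset.sum_le_sum fun j hj => ?_
  have hj := Finset.mem_Ico.1 hj
  rw [abs_mul, abs_of_pos (pow_pos hε _), mul_comm]
  exact mul_le_mul (hC j hj.2 _ ⟨hx.1, dilate_snd_mem_Ioo hε hx.2⟩)
    (pow_le_pow_of_le_one hε.le hε1 (by omega)) (pow_pos hε _).le (hC₀ j)

lemma contDiff_back (hw : ∀ j ≤ k, ContDiff ℝ r (w j)) (hj : j ≤ k) (m : ℕ) :
    ContDiff ℝ r (back w j m) := by
  unfold back
  split_ifs
  · exact hw _ (by omega)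
  · exact contDiff_const

lemma pd_back (i : Fin 2) : pd i (back w j m) = back (fun l => pd i (w l)) j m := by
  unfold back
  split_ifs
  · rfl
  · exact pd_zero

lemma flux_back (i : Fin 2) : flux ν i (back w j m) = back (fun l => flux ν i (w l)) j m := by
  unfold back
  split_ifs
  · rfl
  · funext x
    simp [flux, pd_zero]

lemma back_pd_flux (i i' : Fin 2) :
    back (fun l => pd i (flux ν i' (w l))) j m = pd i (flux ν i' (back w j m)) := by
  rw [flux_back, pd_back]

lemma contDiff_flux (hν : ContDiff ℝ 1 ν) (hv : ContDiff ℝ 2 v) (i : Fin 2) :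
    ContDiff ℝ 1 (flux ν i v) :=
  (hν.comp contDiff_fst).mul (contDiff_pd hv (by norm_num) i)

lemma pd_one_flux (hν : ContDiff ℝ 1 ν) (hv : ContDiff ℝ 2 v) (i : Fin 2) :
    pd 1 (flux ν i v) x = ν x.1 * pd 1 (pd i v) x :=
  pd_one_fst_mul (hν.differentiable one_ne_zero _)
    ((contDiff_pd (m := 1) hv (by norm_num) i).differentiable one_ne_zero x)

lemma velocity_zero : a.velocity k ε 0 = series ε (k + 1) 2 a.u₁ := rfl

lemma velocity_one : a.velocity k ε 1 = series ε (k + 1) 3 a.u₂ := rfl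

lemma pressure_eq : a.pressure k ε = fun x =>
    series ε (k + 1) 1 a.p x + series ε (k + 1) 0 (fun j y => a.q j y.1) x := rfl

namespace IsAnsatz

lemma contDiff_q (h : IsAnsatz ν f₁ k a) :
    ∀ j < k + 1, ContDiff ℝ 1 fun y : ℝ × ℝ => a.q j y.1 := fun j hj =>
  (h.smooth_q j (by omega)).comp contDiff_fst

lemma isClassicalPair (h : IsAnsatz ν f₁ k a) (hε : 0 < ε) :
    IsClassicalPair ε (a.velocity k ε) (a.pressure k ε) where
  smooth i := by
    fin_cases i
    · exact contDiff_series fun j hj => h.smooth_u₁ j (by omega)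
    · exact contDiff_series fun j hj => h.smooth_u₂ j (by omega)
  smooth_pressure := by
    rw [pressure_eq]
    exact (contDiff_series fun j hj => h.smooth_p j (by omega)).add (contDiff_series h.contDiff_q)
  periodic i s t ht := by
    have ht := dilate_snd_mem_Icc (x := (s, t)) hε ht
    fin_cases i
    · exact series_congr (w := a.u₁) fun j hj => h.per_u₁ j (by omega) s _ ht
    · exact series_congr (w := a.u₂) fun j hj => h.per_u₂ j (by omega) s _ ht
  sides t ht := by
    have ht := dilate_snd_mem_Icc (x := (0, t)) hε ⟨ht.1.le, ht.2.le⟩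
    rw [pressure_eq]
    refine congr_arg₂ _ (series_congr fun j hj => ?_) (series_congr fun j hj => ?_)
    · simpa [dilate] using h.per_p j (by omega) 0 _ ht
    · simpa [dilate] using h.per_q j (by omega) 0
  top i s := by
    fin_cases i
    · exact series_eq_zero (w := a.u₁) fun j hj => by
        rw [dilate_top hε.ne', (h.bdry_u₁ j (by omega) s).1]
    · exact series_eq_zero (w := a.u₂) fun j hj => by
        rw [dilate_top hε.ne', (h.bdry_u₂ j (by omega) s).1]
  bot i s := by
    fin_cases i
    · exact series_eq_zero (w := a.u₁) fun j hj => by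
        rw [dilate_bot hε.ne', (h.bdry_u₁ j (by omega) s).2]
    · exact series_eq_zero (w := a.u₂) fun j hj => by
        rw [dilate_bot hε.ne', (h.bdry_u₂ j (by omega) s).2]
  div_free x hx := by
    rw [velocity_zero, velocity_one,
      pd_zero_series fun j hj => (h.smooth_u₁ j (by omega)).differentiable two_ne_zero,
      pd_one_series hε.ne' fun j hj => (h.smooth_u₂ j (by omega)).differentiable two_ne_zero]
    simp only [series, ← Finset.sum_add_distrib, ← mul_add]
    refine Finset.sum_eq_zero fun j hj => ?_
    rw [h.incompressible j (by have := Finset.mem_range.1 hj; omega) _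
      (dilate_snd_mem_Ioo hε hx.2), mul_zero]

lemma differentiable_flux_u₁ (h : IsAnsatz ν f₁ k a) (hν : ContDiff ℝ 1 ν) (i : Fin 2) :
    ∀ j < k + 1, Differentiable ℝ (flux ν i (a.u₁ j)) := fun j hj =>
  (contDiff_flux hν (h.smooth_u₁ j (by omega)) i).differentiable one_ne_zero

lemma differentiable_flux_u₂ (h : IsAnsatz ν f₁ k a) (hν : ContDiff ℝ 1 ν) (i : Fin 2) :
    ∀ j < k + 1, Differentiable ℝ (flux ν i (a.u₂ j)) := fun j hj =>
  (contDiff_flux hν (h.smooth_u₂ j (by omega)) i).differentiable one_ne_zero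

lemma stress_zero_zero (h : IsAnsatz ν f₁ k a) : stress ν (a.velocity k ε) 0 0 =
    series ε (k + 1) 2 fun j => flux ν 0 (a.u₁ j) := by
  funext x
  unfold flux
  rw [← mul_series]
  simp only [stress, symGrad, jac, velocity_zero]
  rw [pd_zero_series fun j hj => (h.smooth_u₁ j (by omega)).differentiable two_ne_zero]
  ring

lemma stress_one_one (h : IsAnsatz ν f₁ k a) (hε : ε ≠ 0) : stress ν (a.velocity k ε) 1 1 =
    series ε (k + 1) 2 fun j => flux ν 1 (a.u₂ j) := by
  funext x
  unfold flux
  rw [← mul_series]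
  simp only [stress, symGrad, jac, velocity_one]
  rw [pd_one_series hε fun j hj => (h.smooth_u₂ j (by omega)).differentiable two_ne_zero]
  ring

lemma stress_zero_one (h : IsAnsatz ν f₁ k a) (hε : ε ≠ 0) :
    stress ν (a.velocity k ε) 0 1 = fun x =>
      1 / 2 * (series ε (k + 1) 1 (fun j => flux ν 1 (a.u₁ j)) x +
        series ε (k + 1) 3 (fun j => flux ν 0 (a.u₂ j)) x) := by
  funext x
  unfold flux
  rw [← mul_series, ← mul_series]
  simp only [stress, symGrad, jac, velocity_one, velocity_zero]
  rw [pd_one_series hε fun j hj => (h.smooth_u₁ j (by omega)).differentiable two_ne_zero,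
    pd_zero_series fun j hj => (h.smooth_u₂ j (by omega)).differentiable two_ne_zero]
  ring

lemma pd_stress_zero_one (h : IsAnsatz ν f₁ k a) (hν : ContDiff ℝ 1 ν) (hε : ε ≠ 0) (i : Fin 2) :
    pd i (stress ν (a.velocity k ε) 0 1) x =
      1 / 2 * (pd i (series ε (k + 1) 1 fun j => flux ν 1 (a.u₁ j)) x +
        pd i (series ε (k + 1) 3 fun j => flux ν 0 (a.u₂ j)) x) := by
  have h₁ : ContDiff ℝ 1 (series ε (k + 1) 1 fun j => flux ν 1 (a.u₁ j)) :=
    contDiff_series fun j hj => contDiff_flux hν (h.smooth_u₁ j (by omega)) 1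
  have h₂ : ContDiff ℝ 1 (series ε (k + 1) 3 fun j => flux ν 0 (a.u₂ j)) :=
    contDiff_series fun j hj => contDiff_flux hν (h.smooth_u₂ j (by omega)) 0
  rw [h.stress_zero_one hε, pd_const_mul _ ((h₁.add h₂).differentiable one_ne_zero x),
    pd_add (h₁.differentiable one_ne_zero x) (h₂.differentiable one_ne_zero x)]

lemma pd_pressure (h : IsAnsatz ν f₁ k a) (i : Fin 2) :
    pd i (a.pressure k ε) x = pd i (series ε (k + 1) 1 a.p) x +
      pd i (series ε (k + 1) 0 fun j y => a.q j y.1) x := by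
  have hp : ContDiff ℝ 1 (series ε (k + 1) 1 a.p) :=
    contDiff_series fun j hj => h.smooth_p j (by omega)
  have hq : ContDiff ℝ 1 (series ε (k + 1) 0 fun j y => a.q j y.1) :=
    contDiff_series h.contDiff_q
  rw [pressure_eq, pd_add (hp.differentiable one_ne_zero x) (hq.differentiable one_ne_zero x)]

lemma force_zero_eq (h : IsAnsatz ν f₁ k a) (hν : ContDiff ℝ 1 ν) (hε : 0 < ε)
    (hx : x ∈ (strip ε : Set (ℝ × ℝ))) : force f₁ 0 x =
      -series ε (k + 1) 0 (fun j => back (fun l => pd 0 (flux ν 0 (a.u₁ l))) j 2) x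
        - 1 / 2 * series ε (k + 1) 0 (fun j => pd 1 (flux ν 1 (a.u₁ j))) x
        - 1 / 2 * series ε (k + 1) 0 (fun j => back (fun l => pd 1 (flux ν 0 (a.u₂ l))) j 2) x
        + series ε (k + 1) 0 (fun j => back (fun l => pd 0 (a.p l)) j 1) x
        + series ε (k + 1) 0 (fun j => pd 0 fun y => a.q j y.1) x := by
  have hforce : force f₁ 0 x = ∑ j ∈ Finset.range (k + 1), ε ^ (j + 0) *
      if j = 0 then f₁ x.1 else 0 := by
    simp [force]
  rw [hforce]
  simp only [series, Finset.mul_sum, ← Finset.sum_neg_distrib, ← Finset.sum_sub_distrib,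
    ← Finset.sum_add_distrib]
  refine Finset.sum_congr rfl fun j hj => ?_
  have hj : j ≤ k := by have := Finset.mem_range.1 hj; omega
  have hmomentum := h.momentum₁ j hj (dilate ε x) (dilate_snd_mem_Ioo hε hx.2)
  change _ = if j = 0 then f₁ x.1 else 0 at hmomentum
  rw [← hmomentum, pd_zero_comp_fst ((h.smooth_q j hj).differentiable one_ne_zero _),
    pd_one_flux hν (h.smooth_u₁ j hj), back_pd_flux, back_pd_flux, ← pd_back,
    pd_one_flux hν (contDiff_back h.smooth_u₂ hj 2)]
  unfold flux
  ring

lemma pd_one_pressure_series (h : IsAnsatz ν f₁ k a) (hν : ContDiff ℝ 1 ν) (hε : 0 < ε)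
    (hx : x ∈ (strip ε : Set (ℝ × ℝ))) : series ε (k + 1) 0 (fun j => pd 1 (a.p j)) x =
      1 / 2 * series ε (k + 1) 0 (fun j => back (fun l => pd 0 (flux ν 1 (a.u₁ l))) j 1) x
        + 1 / 2 * series ε (k + 1) 0 (fun j => back (fun l => pd 0 (flux ν 0 (a.u₂ l))) j 3) x
        + series ε (k + 1) 0 (fun j => back (fun l => pd 1 (flux ν 1 (a.u₂ l))) j 1) x := by
  simp only [series, Finset.mul_sum, ← Finset.sum_add_distrib]
  refine Finset.sum_congr rfl fun j hj => ?_
  have hj : j ≤ k := by have := Finset.mem_range.1 hj; omega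
  have hmomentum := h.momentum₂ j hj (dilate ε x) (dilate_snd_mem_Ioo hε hx.2)
  simp only [mul_add] at hmomentum
  change 1 / 2 * pd 0 (fun y => flux ν 1 (back a.u₁ j 1) y + flux ν 0 (back a.u₂ j 3) y) _ + _ - _
    = _ at hmomentum
  rw [pd_add
    ((contDiff_flux hν (contDiff_back h.smooth_u₁ hj 1) 1).differentiable one_ne_zero _)
    ((contDiff_flux hν (contDiff_back h.smooth_u₂ hj 3) 0).differentiable one_ne_zero _),
    ← pd_one_flux hν (contDiff_back h.smooth_u₂ hj 1)] at hmomentum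
  rw [back_pd_flux, back_pd_flux, back_pd_flux, ← sub_eq_zero.1 hmomentum]
  ring

lemma residual_zero_eq (h : IsAnsatz ν f₁ k a) (hν : ContDiff ℝ 1 ν) (hε : 0 < ε)
    (hx : x ∈ (strip ε : Set (ℝ × ℝ))) :
    residual ν f₁ (a.velocity k ε) (a.pressure k ε) 0 x =
      -remainder ε (k + 1) 2 (fun j => pd 0 (flux ν 0 (a.u₁ j))) x
        - 1 / 2 * remainder ε (k + 1) 2 (fun j => pd 1 (flux ν 0 (a.u₂ j))) x
        + remainder ε (k + 1) 1 (fun j => pd 0 (a.p j)) x := by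
  rw [residual, Fin.sum_univ_two, h.stress_zero_zero, h.pd_stress_zero_one hν hε.ne',
    h.pd_pressure, pd_zero_series (h.differentiable_flux_u₁ hν 0),
    pd_one_series hε.ne' (h.differentiable_flux_u₁ hν 1),
    pd_one_series hε.ne' (h.differentiable_flux_u₂ hν 0),
    pd_zero_series fun j hj => (h.smooth_p j (by omega)).differentiable one_ne_zero,
    pd_zero_series fun j hj => (h.contDiff_q j hj).differentiable one_ne_zero,
    h.force_zero_eq hν hε hx, series_eq_series_back_add_remainder (m := 2),
    series_eq_series_back_add_remainder (m := 2), series_eq_series_back_add_remainder (m := 1)]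
  ring

lemma residual_one_eq (h : IsAnsatz ν f₁ k a) (hν : ContDiff ℝ 1 ν) (hε : 0 < ε)
    (hx : x ∈ (strip ε : Set (ℝ × ℝ))) :
    residual ν f₁ (a.velocity k ε) (a.pressure k ε) 1 x =
      -(1 / 2 * remainder ε (k + 1) 1 (fun j => pd 0 (flux ν 1 (a.u₁ j))) x)
        - 1 / 2 * remainder ε (k + 1) 3 (fun j => pd 0 (flux ν 0 (a.u₂ j))) x
        - remainder ε (k + 1) 1 (fun j => pd 1 (flux ν 1 (a.u₂ j))) x := by
  have hsymm : stress ν (a.velocity k ε) 1 0 = stress ν (a.velocity k ε) 0 1 := by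
    funext x
    simp only [stress, symGrad, add_comm]
  have hq : ContDiff ℝ 1 (series ε (k + 1) 0 fun j y => a.q j y.1) :=
    contDiff_series h.contDiff_q
  have hpressure : pd 1 (a.pressure k ε) x = series ε (k + 1) 0 (fun j => pd 1 (a.p j)) x := by
    rw [h.pd_pressure, pd_one_series hε.ne' fun j hj =>
      (h.smooth_p j (by omega)).differentiable one_ne_zero,
      pd_snd_eq (hq.differentiable one_ne_zero x) (hasDerivAt_const x.2
        (series ε (k + 1) 0 (fun j y => a.q j y.1) x)), add_zero]
  rw [residual, Fin.sum_univ_two, hsymm, h.pd_stress_zero_one hν hε.ne', h.stress_one_one hε.ne',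
    hpressure, pd_zero_series (h.differentiable_flux_u₁ hν 1),
    pd_zero_series (h.differentiable_flux_u₂ hν 0),
    pd_one_series hε.ne' (h.differentiable_flux_u₂ hν 1), h.pd_one_pressure_series hν hε hx,
    series_eq_series_back_add_remainder (m := 1), series_eq_series_back_add_remainder (m := 3),
    series_eq_series_back_add_remainder (m := 1), force, if_neg one_ne_zero]
  ring

lemma exists_abs_residual_le (h : IsAnsatz ν f₁ k a) (hν : ContDiff ℝ 1 ν) :
    ∃ B, 0 ≤ B ∧ ∀ ε, 0 < ε → ε ≤ 1 → ∀ i, ∀ x ∈ (strip ε : Set (ℝ × ℝ)),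
      |residual ν f₁ (a.velocity k ε) (a.pressure k ε) i x| ≤ B * ε ^ (k + 1) := by
  have hu₁ (i i') : ∀ j < k + 1, Continuous (pd i (flux ν i' (a.u₁ j))) := fun j hj =>
    continuous_pd (contDiff_flux hν (h.smooth_u₁ j (by omega)) i') i
  have hu₂ (i i') : ∀ j < k + 1, Continuous (pd i (flux ν i' (a.u₂ j))) := fun j hj =>
    continuous_pd (contDiff_flux hν (h.smooth_u₂ j (by omega)) i') i
  have hp : ∀ j < k + 1, Continuous (pd 0 (a.p j)) := fun j hj =>
    continuous_pd (h.smooth_p j (by omega)) 0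
  obtain ⟨B₁, hB₁, h₁⟩ := exists_abs_remainder_le (k + 1) 2 (hu₁ 0 0)
  obtain ⟨B₂, hB₂, h₂⟩ := exists_abs_remainder_le (k + 1) 2 (hu₂ 1 0)
  obtain ⟨B₃, hB₃, h₃⟩ := exists_abs_remainder_le (k + 1) 1 hp
  obtain ⟨B₄, hB₄, h₄⟩ := exists_abs_remainder_le (k + 1) 1 (hu₁ 0 1)
  obtain ⟨B₅, hB₅, h₅⟩ := exists_abs_remainder_le (k + 1) 3 (hu₂ 0 0)
  obtain ⟨B₆, hB₆, h₆⟩ := exists_abs_remainder_le (k + 1) 1 (hu₂ 1 1)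
  refine ⟨B₁ + B₂ + B₃ + B₄ + B₅ + B₆, by positivity, fun ε hε hε1 i x hx => abs_le.2 ?_⟩
  have hpos {B : ℝ} (hB : 0 ≤ B) : 0 ≤ B * ε ^ (k + 1) := by positivity
  have h₁ := abs_le.1 (h₁ ε hε hε1 x hx)
  have h₂ := abs_le.1 (h₂ ε hε hε1 x hx)
  have h₃ := abs_le.1 (h₃ ε hε hε1 x hx)
  have h₄ := abs_le.1 (h₄ ε hε hε1 x hx)
  have h₅ := abs_le.1 (h₅ ε hε hε1 x hx)
  have h₆ := abs_le.1 (h₆ ε hε hε1 x hx)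
  simp only [add_mul]
  fin_cases i
  · change _ ≤ residual ν f₁ _ _ 0 x ∧ residual ν f₁ _ _ 0 x ≤ _
    rw [h.residual_zero_eq hν hε hx]
    constructor <;> linarith [hpos hB₂, hpos hB₄, hpos hB₅, hpos hB₆]
  · change _ ≤ residual ν f₁ _ _ 1 x ∧ residual ν f₁ _ _ 1 x ≤ _
    rw [h.residual_one_eq hν hε hx]
    constructor <;> linarith [hpos hB₁, hpos hB₂, hpos hB₃, hpos hB₄, hpos hB₅]

theorem exists_error_le (h : IsAnsatz ν f₁ k a) (hκ : 0 < κ) (hν : ContDiff ℝ 1 ν)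
    (hν_per : Function.Periodic ν 1) (hν_ge : ∀ s ∈ Ioo (0 : ℝ) 1, κ ≤ ν s) (hf : Continuous f₁) :
    ∃ C : ℝ, ∀ ε : ℝ, 0 < ε → ε ≤ 1 → ∀ u G, IsWeakSolution ν f₁ ε u G →
      h1Norm (strip ε) (fun i => a.velocity k ε i - u i)
        ≤ ENNReal.ofReal (C * ε ^ ((k : ℝ) + 5 / 2)) ∧
      ∀ p : 𝓓'(strip ε, ℝ), IsPressure ν f₁ ε G p →
        hMinusOneNorm (strip ε) (fun i =>
          grad (funDistribution (strip ε) (a.pressure k ε)) i - grad p i)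
          ≤ ENNReal.ofReal (C * ε ^ ((k : ℝ) + 5 / 2)) := by
  obtain ⟨B, hB, hres⟩ := h.exists_abs_residual_le hν
  obtain ⟨M, hM⟩ := (isCompact_Icc (a := (0 : ℝ)) (b := 1)).exists_bound_of_continuousOn
    hν.continuous.continuousOn
  have hM₀ : 0 ≤ M := (norm_nonneg _).trans (hM 0 ⟨le_rfl, zero_le_one⟩)
  refine ⟨2 * B + 8 / κ * B + 16 / κ * (M * B), fun ε hε hε1 u G hu => ?_⟩
  have hpow : B * ε ^ (k + 1) * (ε * √ε) = B * ε ^ ((k : ℝ) + 5 / 2) := by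
    rw [Real.sqrt_eq_rpow, mul_assoc, ← mul_assoc (ε ^ (k + 1)), ← pow_succ, ← Real.rpow_natCast,
      ← Real.rpow_add hε]
    push_cast
    ring_nf
  have hclassical := h.isClassicalPair hε
  have hBε : 0 ≤ B * ε ^ (k + 1) := by positivity
  have herr := hu.sqrt_dirichlet_error_le hκ hBε hε hν hν_per hν_ge hf hclassical (hres ε hε hε1)
  rw [hpow] at herr
  set R := ε ^ ((k : ℝ) + 5 / 2)
  have hR : 0 ≤ R := by positivity
  refine ⟨(h1Norm_le hε hε1 ((hclassical.memHPer hε).sub hu.mem).comp).trans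
    (ENNReal.ofReal_le_ofReal ?_), fun p hp => (hp.hMinusOneNorm_error_le hBε hM₀ hε hν hν_per
      (fun s hs => hM s ⟨hs.1.le, hs.2.le⟩) hf hclassical (hres ε hε hε1)
      fun i j => (hu.mem.comp i).memLp_grad j).trans (ENNReal.ofReal_le_ofReal ?_)⟩
  · have hslack : 0 ≤ (2 * B + 16 / κ * (M * B)) * R := mul_nonneg (by positivity) hR
    linear_combination 2 * herr + hslack
  · have hslack : 0 ≤ 8 / κ * B * R := mul_nonneg (by positivity) hR
    rw [hpow]
    linear_combination 4 * M * herr + hslack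

end IsAnsatz

end Ansatz

/-! ### Periodic functions of one variable -/

section Periodic

variable {ν c d g : ℝ → ℝ} {κ : ℝ}

lemma le_of_periodic (hν : Continuous ν) (hν_per : Function.Periodic ν 1)
    (hν_ge : ∀ s ∈ Ioo (0 : ℝ) 1, κ ≤ ν s) (s : ℝ) : κ ≤ ν s := by
  obtain ⟨t, ht, hst⟩ := hν_per.exists_mem_Ico₀ zero_lt_one s
  have hclosure : closure (Ioo (0 : ℝ) 1) ⊆ {t | κ ≤ ν t} :=
    closure_minimal hν_ge (isClosed_le continuous_const hν)
  rw [closure_Ioo zero_ne_one] at hclosure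
  exact hst ▸ hclosure (Ico_subset_Icc_self ht)

lemma periodic_deriv (hc : Function.Periodic c 1) : Function.Periodic (deriv c) 1 := fun s => by
  rw [← deriv_comp_add_const, hc.funext]

lemma exists_periodic_primitive (hg : Continuous g) (hg_per : Function.Periodic g 1)
    (hmean : ∫ s in (0 : ℝ)..1, g s = 0) :
    ∃ q : ℝ → ℝ, Function.Periodic q 1 ∧ ∀ s, HasDerivAt q (g s) s := by
  refine ⟨fun s => ∫ τ in (0 : ℝ)..s, g τ, fun s => ?_,
    fun s => (hg.integral_hasStrictDerivAt 0 s).hasDerivAt⟩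
  have hperiod : ∫ τ in s..(s + 1), g τ = 0 := by
    rw [hg_per.intervalIntegral_add_eq s 0, zero_add, hmean]
  beta_reduce
  rw [← intervalIntegral.integral_add_adjacent_intervals
    (hg.intervalIntegrable (μ := volume) 0 s) (hg.intervalIntegrable s (s + 1)), hperiod, add_zero]

lemma exists_eq_const_mul_add_deriv (hν : Continuous ν) (hν_per : Function.Periodic ν 1)
    (hpos : ∀ s, 0 < ν s) (hg : Continuous g) (hg_per : Function.Periodic g 1) :
    ∃ (m : ℝ) (q : ℝ → ℝ), Differentiable ℝ q ∧ Function.Periodic q 1 ∧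
      ∀ s, g s = m * ν s + deriv q s := by
  have hint : 0 < ∫ s in (0 : ℝ)..1, ν s :=
    intervalIntegral.intervalIntegral_pos_of_pos (hν.intervalIntegrable _ _) hpos zero_lt_one
  set m := (∫ s in (0 : ℝ)..1, g s) / ∫ s in (0 : ℝ)..1, ν s
  have hmean : ∫ s in (0 : ℝ)..1, (g s - m * ν s) = 0 := by
    rw [intervalIntegral.integral_sub (hg.intervalIntegrable _ _)
      ((hν.intervalIntegrable _ _).const_mul _), intervalIntegral.integral_const_mul,
      div_mul_cancel₀ _ hint.ne', sub_self]
  have hcont : Continuous fun s => g s - m * ν s := hg.sub (continuous_const.mul hν)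
  obtain ⟨q, hq_per, hq⟩ := exists_periodic_primitive hcont
    (fun s => by simp only [hν_per s, hg_per s]) hmean
  exact ⟨m, q, fun s => (hq s).differentiableAt, hq_per, fun s => by rw [(hq s).deriv]; ring⟩

/-- Smooth `1`-periodic functions, the coefficients of the profiles below. -/
structure IsSmoothPeriodic (c : ℝ → ℝ) : Prop where
  smooth : ContDiff ℝ ∞ c
  periodic : Function.Periodic c 1

namespace IsSmoothPeriodic

lemma differentiable (hc : IsSmoothPeriodic c) : Differentiable ℝ c :=
  hc.smooth.differentiable (by simp)

protected lemma deriv (hc : IsSmoothPeriodic c) : IsSmoothPeriodic (deriv c) where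
  smooth := (contDiff_infty_iff_deriv.1 hc.smooth).2
  periodic := periodic_deriv hc.periodic

protected lemma mul (hc : IsSmoothPeriodic c) (hd : IsSmoothPeriodic d) :
    IsSmoothPeriodic fun s => c s * d s where
  smooth := hc.smooth.mul hd.smooth
  periodic := hc.periodic.mul hd.periodic

protected lemma sub (hc : IsSmoothPeriodic c) (hd : IsSmoothPeriodic d) :
    IsSmoothPeriodic fun s => c s - d s where
  smooth := hc.smooth.sub hd.smooth
  periodic := hc.periodic.sub hd.periodic

protected lemma const (r : ℝ) : IsSmoothPeriodic fun _ => r where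
  smooth := contDiff_const
  periodic _ := rfl

lemma const_div (hc : IsSmoothPeriodic c) (hne : ∀ s, c s ≠ 0) (r : ℝ) :
    IsSmoothPeriodic fun s => r / c s where
  smooth := contDiff_const.div hc.smooth hne
  periodic s := by simp only [hc.periodic s]

lemma exists_eq_const_mul_add_deriv (hν : IsSmoothPeriodic ν) (hpos : ∀ s, 0 < ν s)
    (hg : IsSmoothPeriodic g) :
    ∃ (m : ℝ) (q : ℝ → ℝ), IsSmoothPeriodic q ∧ ∀ s, g s = m * ν s + deriv q s := by
  obtain ⟨m, q, hq, hq_per, hgq⟩ := ThinStokes.exists_eq_const_mul_add_deriv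
    hν.smooth.continuous hν.periodic hpos hg.smooth.continuous hg.periodic
  have hderiv : deriv q = fun s => g s - m * ν s := funext fun s => by rw [hgq]; ring
  refine ⟨m, q, ⟨contDiff_infty_iff_deriv.2 ⟨hq, ?_⟩, hq_per⟩, hgq⟩
  rw [hderiv]
  exact (hg.sub ((IsSmoothPeriodic.const m).mul hν)).smooth

end IsSmoothPeriodic

end Periodic

/-! ### Polynomial profiles -/

section Profiles

variable {ν c g : ℝ → ℝ} {v w : ℝ × ℝ → ℝ}

/-- The space in which the coefficients of the ansatz are constructed: polynomials in the second
variable whose coefficients are smooth periodic functions of the first one. -/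
def profiles : Submodule ℝ (ℝ × ℝ → ℝ) :=
  Submodule.span ℝ {w | ∃ (c : ℝ → ℝ) (n : ℕ), IsSmoothPeriodic c ∧ w = fun x => c x.1 * x.2 ^ n}

lemma mul_pow_mem_profiles (hc : IsSmoothPeriodic c) (n : ℕ) :
    (fun x : ℝ × ℝ => c x.1 * x.2 ^ n) ∈ profiles :=
  Submodule.subset_span ⟨c, n, hc, rfl⟩

lemma fst_mem_profiles (hc : IsSmoothPeriodic c) : (fun x : ℝ × ℝ => c x.1) ∈ profiles := by
  simpa only [pow_zero, mul_one] using mul_pow_mem_profiles hc 0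

lemma add_mem_profiles (hw : w ∈ profiles) (hv : v ∈ profiles) :
    (fun x => w x + v x) ∈ profiles := profiles.add_mem hw hv

lemma sub_mem_profiles (hw : w ∈ profiles) (hv : v ∈ profiles) :
    (fun x => w x - v x) ∈ profiles := profiles.sub_mem hw hv

lemma const_mul_mem_profiles (r : ℝ) (hw : w ∈ profiles) : (fun x => r * w x) ∈ profiles :=
  profiles.smul_mem r hw

lemma fst_mul_mem_profiles (hg : IsSmoothPeriodic g) (hw : w ∈ profiles) :
    (fun x => g x.1 * w x) ∈ profiles := by
  induction hw using Submodule.span_induction with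
  | mem w h =>
    obtain ⟨c, n, hc, rfl⟩ := h
    simpa only [mul_assoc] using mul_pow_mem_profiles (hg.mul hc) n
  | zero =>
    simp only [Pi.zero_apply, mul_zero]
    exact profiles.zero_mem
  | add w v _ _ hw hv => simpa only [Pi.add_apply, mul_add] using add_mem_profiles hw hv
  | smul r w _ hw =>
    simpa only [Pi.smul_apply, smul_eq_mul, mul_left_comm] using const_mul_mem_profiles r hw

lemma contDiff_of_mem_profiles (hw : w ∈ profiles) : ContDiff ℝ ∞ w := by
  induction hw using Submodule.span_induction with
  | mem w h =>
    obtain ⟨c, n, hc, rfl⟩ := h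
    exact (hc.smooth.comp contDiff_fst).mul (contDiff_snd.pow n)
  | zero => exact contDiff_const
  | add w v _ _ hw hv => exact hw.add hv
  | smul r w _ hw => exact contDiff_const.mul hw

lemma contDiff_two_of_mem_profiles (hw : w ∈ profiles) : ContDiff ℝ 2 w :=
  (contDiff_of_mem_profiles hw).of_le (WithTop.coe_le_coe.2 (le_top : (2 : ℕ∞) ≤ ⊤))

lemma differentiable_of_mem_profiles (hw : w ∈ profiles) : Differentiable ℝ w :=
  (contDiff_two_of_mem_profiles hw).differentiable two_ne_zero

lemma periodic_of_mem_profiles (hw : w ∈ profiles) (s t : ℝ) : w (s + 1, t) = w (s, t) := by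
  induction hw using Submodule.span_induction with
  | mem w h =>
    obtain ⟨c, n, hc, rfl⟩ := h
    simp only [hc.periodic s]
  | zero => rfl
  | add w v _ _ hw hv => simp only [Pi.add_apply, hw, hv]
  | smul r w _ hw => simp only [Pi.smul_apply, hw]

lemma isSmoothPeriodic_trace (hw : w ∈ profiles) (t : ℝ) : IsSmoothPeriodic fun s => w (s, t) where
  smooth := (contDiff_of_mem_profiles hw).comp (contDiff_id.prodMk contDiff_const)
  periodic s := periodic_of_mem_profiles hw s t

lemma pd_mem_profiles (hw : w ∈ profiles) (i : Fin 2) : pd i w ∈ profiles := by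
  induction hw using Submodule.span_induction with
  | mem w h =>
    obtain ⟨c, n, hc, rfl⟩ := h
    have hdiff := differentiable_of_mem_profiles (mul_pow_mem_profiles hc n)
    fin_cases i
    · convert mul_pow_mem_profiles hc.deriv n using 1
      funext x
      exact pd_fst_eq (hdiff x) ((hc.differentiable x.1).hasDerivAt.mul_const (x.2 ^ n))
    · convert const_mul_mem_profiles n (mul_pow_mem_profiles hc (n - 1)) using 1
      funext x
      refine pd_snd_eq (hdiff x) (((hasDerivAt_pow n x.2).const_mul (c x.1)).congr_deriv ?_)
      ring
  | zero => rw [pd_zero]; exact profiles.zero_mem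
  | add w v hw hv hpd_w hpd_v =>
    convert add_mem_profiles hpd_w hpd_v using 1
    funext x
    exact pd_add (differentiable_of_mem_profiles hw x) (differentiable_of_mem_profiles hv x)
  | smul r w hw hpd_w =>
    convert const_mul_mem_profiles r hpd_w using 1
    funext x
    exact pd_const_mul r (differentiable_of_mem_profiles hw x)

lemma pd_one_sub_fst (hw : w ∈ profiles) (hc : IsSmoothPeriodic c) :
    pd 1 (fun x => w x - c x.1) = pd 1 w := by
  funext x
  rw [pd_sub (differentiable_of_mem_profiles hw x)
    (differentiable_of_mem_profiles (fst_mem_profiles hc) x),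
    pd_one_comp_fst (hc.differentiable _), sub_zero]

lemma exists_primitive (hw : w ∈ profiles) : ∃ I ∈ profiles, pd 1 I = w := by
  induction hw using Submodule.span_induction with
  | mem w h =>
    obtain ⟨c, n, hc, rfl⟩ := h
    have hmem := const_mul_mem_profiles (n + 1 : ℝ)⁻¹ (mul_pow_mem_profiles hc (n + 1))
    refine ⟨_, hmem, funext fun x => pd_snd_eq (differentiable_of_mem_profiles hmem x)
      ((((hasDerivAt_pow (n + 1) x.2).const_mul (c x.1)).const_mul _).congr_deriv ?_)⟩
    push_cast
    field_simp
  | zero => exact ⟨0, profiles.zero_mem, pd_zero⟩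
  | add w v _ _ hw hv =>
    obtain ⟨I, hI, rfl⟩ := hw
    obtain ⟨J, hJ, rfl⟩ := hv
    exact ⟨_, add_mem_profiles hI hJ, funext fun x =>
      pd_add (differentiable_of_mem_profiles hI x) (differentiable_of_mem_profiles hJ x)⟩
  | smul r w _ hw =>
    obtain ⟨I, hI, rfl⟩ := hw
    exact ⟨_, const_mul_mem_profiles r hI, funext fun x =>
      pd_const_mul r (differentiable_of_mem_profiles hI x)⟩

lemma exists_primitive_vanishing (hw : w ∈ profiles) (t : ℝ) :
    ∃ I ∈ profiles, pd 1 I = w ∧ ∀ s, I (s, t) = 0 := by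
  obtain ⟨I, hI, rfl⟩ := exists_primitive hw
  have htrace := isSmoothPeriodic_trace hI t
  exact ⟨_, sub_mem_profiles hI (fst_mem_profiles htrace), pd_one_sub_fst hI htrace,
    fun s => sub_self _⟩

lemma integral_pd_one (hw : w ∈ profiles) (s a b : ℝ) :
    ∫ t in a..b, pd 1 w (s, t) = w (s, b) - w (s, a) :=
  intervalIntegral.integral_eq_sub_of_hasDerivAt (f := fun t => w (s, t))
    (fun t _ => hasDerivAt_snd (x := (s, t)) (differentiable_of_mem_profiles hw _))
    (((contDiff_of_mem_profiles (pd_mem_profiles hw 1)).continuous.comp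
      (continuous_const.prodMk continuous_id)).intervalIntegrable _ _)

lemma exists_primitive_mean_zero (hw : w ∈ profiles) :
    ∃ I ∈ profiles, pd 1 I = w ∧ ∀ s, ∫ ξ in (-(1 / 2) : ℝ)..(1 / 2), I (s, ξ) = 0 := by
  obtain ⟨J, hJ, rfl⟩ := exists_primitive hw
  obtain ⟨R, hR, rfl⟩ := exists_primitive hJ
  have hmean := (isSmoothPeriodic_trace hR (1 / 2)).sub (isSmoothPeriodic_trace hR (-(1 / 2)))
  refine ⟨_, sub_mem_profiles hJ (fst_mem_profiles hmean), pd_one_sub_fst hJ hmean, fun s => ?_⟩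
  have hcont : Continuous fun ξ => pd 1 R (s, ξ) :=
    (contDiff_of_mem_profiles hJ).continuous.comp (continuous_const.prodMk continuous_id)
  change ∫ ξ in _..(1 / 2 : ℝ), (pd 1 R (s, ξ) - (R (s, 1 / 2) - R (s, -(1 / 2)))) = 0
  rw [intervalIntegral.integral_sub (hcont.intervalIntegrable _ _)
    (continuous_const.intervalIntegrable _ _), integral_pd_one hR, intervalIntegral.integral_const]
  norm_num

lemma exists_dirichlet_solution (hw : w ∈ profiles) :
    ∃ U ∈ profiles, pd 1 (pd 1 U) = w ∧ ∀ s, U (s, 1 / 2) = 0 ∧ U (s, -(1 / 2)) = 0 := by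
  obtain ⟨I, hI, rfl⟩ := exists_primitive hw
  obtain ⟨J, hJ, rfl, hJ_bot⟩ := exists_primitive_vanishing hI (-(1 / 2))
  have htrace := isSmoothPeriodic_trace hJ (1 / 2)
  have hlinear : (fun x : ℝ × ℝ => J (x.1, 1 / 2) * (x.2 + 1 / 2)) ∈ profiles := by
    convert add_mem_profiles (mul_pow_mem_profiles htrace 1)
      (const_mul_mem_profiles (1 / 2) (fst_mem_profiles htrace)) using 2
    ring
  have hpd : pd 1 (fun x => J x - J (x.1, 1 / 2) * (x.2 + 1 / 2)) =
      fun x => pd 1 J x - J (x.1, 1 / 2) := by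
    funext x
    rw [pd_sub (differentiable_of_mem_profiles hJ x) (differentiable_of_mem_profiles hlinear x),
      pd_one_fst_mul_snd (g := fun t => t + 1 / 2) htrace.differentiable (by fun_prop)]
    simp
  refine ⟨_, sub_mem_profiles hJ hlinear, ?_, fun s => ⟨by ring, ?_⟩⟩
  · rw [hpd, pd_one_sub_fst hI htrace]
  · rw [hJ_bot]
    ring

lemma exists_clamped_solution (hw : w ∈ profiles) :
    ∃ V ∈ profiles, pd 1 (pd 1 (pd 1 V)) = w ∧
      (∀ s, pd 1 V (s, 1 / 2) = 0 ∧ pd 1 V (s, -(1 / 2)) = 0) ∧ ∀ s, V (s, -(1 / 2)) = 0 := by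
  obtain ⟨U, hU, hU_eq, hU_bdry⟩ := exists_dirichlet_solution hw
  obtain ⟨V, hV, rfl, hV_bot⟩ := exists_primitive_vanishing hU (-(1 / 2))
  exact ⟨V, hV, hU_eq, hU_bdry, hV_bot⟩

/-- The cubic with third derivative `1` which vanishes at `-1/2` and whose derivative vanishes at
`±1/2`: the stream function of the Poiseuille flow driven by a unit pressure gradient. -/
def clampedCubic (t : ℝ) : ℝ := (t + 1 / 2) ^ 2 * (t - 1) / 6

lemma fst_mul_clampedCubic_mem_profiles (hc : IsSmoothPeriodic c) :
    (fun x : ℝ × ℝ => c x.1 * clampedCubic x.2) ∈ profiles := by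
  convert sub_mem_profiles (const_mul_mem_profiles (1 / 6) (mul_pow_mem_profiles hc 3))
    (add_mem_profiles (const_mul_mem_profiles (1 / 8) (mul_pow_mem_profiles hc 1))
      (const_mul_mem_profiles (1 / 24) (fst_mem_profiles hc))) using 2
  unfold clampedCubic
  ring

lemma pd_one_fst_mul_clampedCubic (hc : Differentiable ℝ c) :
    pd 1 (fun x => c x.1 * clampedCubic x.2) = fun x => c x.1 * ((x.2 ^ 2 - 1 / 4) / 2) := by
  have hderiv : deriv clampedCubic = fun t => (t ^ 2 - 1 / 4) / 2 := by
    funext t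
    unfold clampedCubic
    simp
    ring
  rw [pd_one_fst_mul_snd hc (by unfold clampedCubic; fun_prop), hderiv]

lemma pd_one_pd_one_pd_one_fst_mul_clampedCubic (hc : Differentiable ℝ c) :
    pd 1 (pd 1 (pd 1 fun x => c x.1 * clampedCubic x.2)) = fun x => c x.1 := by
  rw [pd_one_fst_mul_clampedCubic hc,
    pd_one_fst_mul_snd (g := fun t => (t ^ 2 - 1 / 4) / 2) hc (by fun_prop)]
  have hderiv : (deriv fun t : ℝ => (t ^ 2 - 1 / 4) / 2) = fun t => t := by
    funext t
    simp
  rw [hderiv, pd_one_fst_mul_snd (g := fun t => t) hc differentiable_id]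
  simp only [deriv_id'', mul_one]

lemma pd_one_fst_mul_of_mem_profiles (hc : Differentiable ℝ c) (hw : w ∈ profiles) :
    pd 1 (fun x => c x.1 * w x) = fun x => c x.1 * pd 1 w x :=
  funext fun x => pd_one_fst_mul (hc _) (differentiable_of_mem_profiles hw x)

lemma pd_one_add_of_mem_profiles (hw : w ∈ profiles) (hv : v ∈ profiles) :
    pd 1 (fun x => w x + v x) = fun x => pd 1 w x + pd 1 v x :=
  funext fun x => pd_add (differentiable_of_mem_profiles hw x) (differentiable_of_mem_profiles hv x)

lemma pd_one_iterate_fst_mul_of_mem_profiles (hc : Differentiable ℝ c) (hw : w ∈ profiles) :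
    pd 1 (pd 1 (pd 1 fun x => c x.1 * w x)) = fun x => c x.1 * pd 1 (pd 1 (pd 1 w)) x := by
  rw [pd_one_fst_mul_of_mem_profiles hc hw,
    pd_one_fst_mul_of_mem_profiles hc (pd_mem_profiles hw 1),
    pd_one_fst_mul_of_mem_profiles hc (pd_mem_profiles (pd_mem_profiles hw 1) 1)]

lemma pd_one_iterate_add_of_mem_profiles (hw : w ∈ profiles) (hv : v ∈ profiles) :
    pd 1 (pd 1 (pd 1 fun x => w x + v x)) =
      fun x => pd 1 (pd 1 (pd 1 w)) x + pd 1 (pd 1 (pd 1 v)) x := by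
  rw [pd_one_add_of_mem_profiles hw hv,
    pd_one_add_of_mem_profiles (pd_mem_profiles hw 1) (pd_mem_profiles hv 1),
    pd_one_add_of_mem_profiles (pd_mem_profiles (pd_mem_profiles hw 1) 1)
      (pd_mem_profiles (pd_mem_profiles hv 1) 1)]

lemma pd_zero_eq_zero_of_trace_eq {r t : ℝ} (hw : w ∈ profiles) (htrace : ∀ s, w (s, t) = r)
    (s : ℝ) : pd 0 w (s, t) = 0 :=
  pd_fst_eq (differentiable_of_mem_profiles hw _)
    ((hasDerivAt_const s r).congr_of_eventuallyEq (.of_forall htrace))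

/-- The velocity `(∂₂Q, -∂₁Q)` vanishes on the horizontal sides as soon as `∂₂Q` does and `Q` is
constant on each of them. The clamped solution for `w` violates the latter; the cubic with
coefficient `q'` corrects its flux, and leaves the constant `m / 6`. -/
lemma exists_stream_function (hν : IsSmoothPeriodic ν) (hpos : ∀ s, 0 < ν s) (hw : w ∈ profiles) :
    ∃ Q ∈ profiles, ∃ q, IsSmoothPeriodic q ∧
      (∀ x, ν x.1 / 2 * pd 1 (pd 1 (pd 1 Q)) x = w x + deriv q x.1) ∧
      (∀ s, pd 1 Q (s, 1 / 2) = 0 ∧ pd 1 Q (s, -(1 / 2)) = 0) ∧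
      ∀ s, pd 0 Q (s, 1 / 2) = 0 ∧ pd 0 Q (s, -(1 / 2)) = 0 := by
  obtain ⟨V, hV, rfl, hV_bdry, hV_bot⟩ := exists_clamped_solution hw
  obtain ⟨m, q, hq, hflux⟩ := hν.exists_eq_const_mul_add_deriv hpos
    ((IsSmoothPeriodic.const 12).mul (isSmoothPeriodic_trace hV (1 / 2)))
  have hq' := hq.deriv.differentiable
  have hinv := hν.const_div (fun s => (hpos s).ne') 2
  have hcubic := fst_mul_clampedCubic_mem_profiles hq.deriv
  have hsum := add_mem_profiles hV hcubic
  have hQ := fst_mul_mem_profiles hinv hsum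
  set Q : ℝ × ℝ → ℝ := fun x => 2 / ν x.1 * (V x + deriv q x.1 * clampedCubic x.2)
  have hpd : pd 1 Q = fun x => 2 / ν x.1 * (pd 1 V x + deriv q x.1 * ((x.2 ^ 2 - 1 / 4) / 2)) := by
    rw [pd_one_fst_mul_of_mem_profiles hinv.differentiable hsum,
      pd_one_add_of_mem_profiles hV hcubic, pd_one_fst_mul_clampedCubic hq']
  have hpd₃ (x) : pd 1 (pd 1 (pd 1 Q)) x = 2 / ν x.1 * (pd 1 (pd 1 (pd 1 V)) x + deriv q x.1) := by
    rw [pd_one_iterate_fst_mul_of_mem_profiles hinv.differentiable hsum,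
      pd_one_iterate_add_of_mem_profiles hV hcubic, pd_one_pd_one_pd_one_fst_mul_clampedCubic hq']
  have hQ_top (s) : Q (s, 1 / 2) = m / 6 := by
    have hV_top : V (s, 1 / 2) = (m * ν s + deriv q s) / 12 := by linarith [hflux s]
    have hν_ne := (hpos s).ne'
    simp only [Q, hV_top, clampedCubic]
    field_simp
    ring
  have hQ_bot (s) : Q (s, -(1 / 2)) = 0 := by
    simp only [Q, hV_bot, clampedCubic]
    ring
  refine ⟨Q, hQ, q, hq, fun x => ?_, fun s => ?_, fun s =>
    ⟨pd_zero_eq_zero_of_trace_eq hQ hQ_top s, pd_zero_eq_zero_of_trace_eq hQ hQ_bot s⟩⟩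
  · have hν_ne := (hpos x.1).ne'
    rw [hpd₃]
    field_simp
  · simp only [hpd, (hV_bdry s).1, (hV_bdry s).2]
    constructor <;> ring

end Profiles

/-! ### Existence of the coefficients -/

section Existence

variable {ν f₁ q : ℝ → ℝ} {u₁ u₂ p S₁ S₂ : ℝ × ℝ → ℝ} {a : Coeffs} {j k m n : ℕ}

/-- The equations of one order for smooth coefficients `u₁`, `u₂`, `p`, `q`; the terms that involve
the lower orders and the force are collected in the sources `S₁` and `S₂`. -/
structure SolvesOrder (ν : ℝ → ℝ) (S₁ S₂ u₁ u₂ p : ℝ × ℝ → ℝ) (q : ℝ → ℝ) : Prop where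
  mem_u₁ : u₁ ∈ profiles
  mem_u₂ : u₂ ∈ profiles
  mem_p : p ∈ profiles
  smooth_q : IsSmoothPeriodic q
  mean_p : ∀ s, ∫ ξ in (-(1 / 2) : ℝ)..(1 / 2), p (s, ξ) = 0
  momentum₁ : ∀ x, ν x.1 / 2 * pd 1 (pd 1 u₁) x = S₁ x + deriv q x.1
  momentum₂ : pd 1 p = S₂
  incompressible : ∀ x, pd 0 u₁ x + pd 1 u₂ x = 0
  bdry_u₁ : ∀ s, u₁ (s, 1 / 2) = 0 ∧ u₁ (s, -(1 / 2)) = 0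
  bdry_u₂ : ∀ s, u₂ (s, 1 / 2) = 0 ∧ u₂ (s, -(1 / 2)) = 0

lemma exists_solvesOrder (hν : IsSmoothPeriodic ν) (hpos : ∀ s, 0 < ν s) (hS₁ : S₁ ∈ profiles)
    (hS₂ : S₂ ∈ profiles) : ∃ u₁ u₂ p q, SolvesOrder ν S₁ S₂ u₁ u₂ p q := by
  obtain ⟨Q, hQ, q, hq, hQ_eq, hQ_bdry₁, hQ_bdry₀⟩ := exists_stream_function hν hpos hS₁
  obtain ⟨p, hp, hp_eq, hp_mean⟩ := exists_primitive_mean_zero hS₂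
  exact ⟨pd 1 Q, fun x => -pd 0 Q x, p, q,
    { mem_u₁ := pd_mem_profiles hQ 1
      mem_u₂ := profiles.neg_mem (pd_mem_profiles hQ 0)
      mem_p := hp
      smooth_q := hq
      mean_p := hp_mean
      momentum₁ := hQ_eq
      momentum₂ := hp_eq
      incompressible := fun x => by
        rw [pd_neg, pd_comm (i := 0) (j := 1) (contDiff_two_of_mem_profiles hQ), add_neg_cancel]
      bdry_u₁ := hQ_bdry₁
      bdry_u₂ := fun s => by simp only [(hQ_bdry₀ s).1, (hQ_bdry₀ s).2, neg_zero, and_self] }⟩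

/-- The terms of the first momentum equation of order `j` that involve the lower orders or the
force, with the sign they have on the side opposite to the viscous term. -/
def momentumSource (ν f₁ : ℝ → ℝ) (a : Coeffs) (j : ℕ) (x : ℝ × ℝ) : ℝ :=
  -pd 0 (fun y => ν y.1 * pd 0 (back a.u₁ j 2) y) x - ν x.1 / 2 * pd 1 (pd 0 (back a.u₂ j 2)) x
    + pd 0 (back a.p j 1) x - if j = 0 then f₁ x.1 else 0

/-- The value of `∂p_j/∂ξ₂` prescribed by the second momentum equation of order `j`, which only
involves lower orders. -/
def pressureSource (ν : ℝ → ℝ) (a : Coeffs) (j : ℕ) (x : ℝ × ℝ) : ℝ :=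
  1 / 2 * pd 0 (fun y => ν y.1 * (pd 1 (back a.u₁ j 1) y + pd 0 (back a.u₂ j 3) y)) x
    + ν x.1 * pd 1 (pd 1 (back a.u₂ j 1)) x

/-- All the equations of order `j` hold, with smooth coefficients. -/
def Coeffs.SolvesAt (a : Coeffs) (ν f₁ : ℝ → ℝ) (j : ℕ) : Prop :=
  SolvesOrder ν (momentumSource ν f₁ a j) (pressureSource ν a j) (a.u₁ j) (a.u₂ j) (a.p j) (a.q j)

lemma back_mem_profiles {w : ℕ → ℝ × ℝ → ℝ} (hw : ∀ j < n, w j ∈ profiles) (hm : m ≠ 0) :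
    back w n m ∈ profiles := by
  unfold back
  split_ifs
  · exact hw _ (by omega)
  · exact profiles.zero_mem

lemma momentumSource_mem_profiles (hν : IsSmoothPeriodic ν) (hf : IsSmoothPeriodic f₁)
    (ha : ∀ j < n, a.SolvesAt ν f₁ j) : momentumSource ν f₁ a n ∈ profiles := by
  have hu₁ := pd_mem_profiles (back_mem_profiles (fun j hj => (ha j hj).mem_u₁) two_ne_zero) 0
  have hu₂ := pd_mem_profiles (back_mem_profiles (fun j hj => (ha j hj).mem_u₂) two_ne_zero) 0
  have hp := pd_mem_profiles (back_mem_profiles (fun j hj => (ha j hj).mem_p) one_ne_zero) 0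
  have hforce : IsSmoothPeriodic fun s => if n = 0 then f₁ s else 0 := by
    split_ifs
    exacts [hf, .const 0]
  have hflux := profiles.neg_mem (pd_mem_profiles (fst_mul_mem_profiles hν hu₁) 0)
  have hhalf := fst_mul_mem_profiles (hν.mul (.const (1 / 2))) (pd_mem_profiles hu₂ 1)
  convert sub_mem_profiles (add_mem_profiles (sub_mem_profiles hflux hhalf) hp)
    (fst_mem_profiles hforce) using 2
  simp only [momentumSource, Pi.neg_apply, mul_one_div]

lemma pressureSource_mem_profiles (hν : IsSmoothPeriodic ν) (ha : ∀ j < n, a.SolvesAt ν f₁ j) :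
    pressureSource ν a n ∈ profiles := by
  have hu₁ {m} := back_mem_profiles (m := m) fun j hj => (ha j hj).mem_u₁
  have hu₂ {m} := back_mem_profiles (m := m) fun j hj => (ha j hj).mem_u₂
  have hshear := add_mem_profiles (pd_mem_profiles (hu₁ one_ne_zero) 1)
    (pd_mem_profiles (hu₂ three_ne_zero) 0)
  exact add_mem_profiles
    (const_mul_mem_profiles _ (pd_mem_profiles (fst_mul_mem_profiles hν hshear) 0))
    (fst_mul_mem_profiles hν (pd_mem_profiles (pd_mem_profiles (hu₂ one_ne_zero) 1) 1))

/-- The coefficients `a` with those of index `n` replaced. -/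
def Coeffs.update (a : Coeffs) (n : ℕ) (u₁ u₂ p : ℝ × ℝ → ℝ) (q : ℝ → ℝ) : Coeffs :=
  ⟨Function.update a.u₁ n u₁, Function.update a.u₂ n u₂, Function.update a.p n p,
    Function.update a.q n q⟩

lemma back_update (w : ℕ → ℝ × ℝ → ℝ) (v : ℝ × ℝ → ℝ) (hj : j ≤ n) (hm : m ≠ 0) :
    back (Function.update w n v) j m = back w j m := by
  unfold back
  split_ifs
  · rw [Function.update_of_ne (by omega)]
  · rfl

lemma momentumSource_update (hj : j ≤ n) :
    momentumSource ν f₁ (a.update n u₁ u₂ p q) j = momentumSource ν f₁ a j := by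
  funext x
  simp only [momentumSource, Coeffs.update, back_update _ _ hj two_ne_zero,
    back_update _ _ hj one_ne_zero]

lemma pressureSource_update (hj : j ≤ n) :
    pressureSource ν (a.update n u₁ u₂ p q) j = pressureSource ν a j := by
  funext x
  simp only [pressureSource, Coeffs.update, back_update _ _ hj one_ne_zero,
    back_update _ _ hj three_ne_zero]

lemma solvesAt_update_of_lt (hj : j < n) :
    (a.update n u₁ u₂ p q).SolvesAt ν f₁ j ↔ a.SolvesAt ν f₁ j := by
  unfold Coeffs.SolvesAt
  rw [momentumSource_update hj.le, pressureSource_update hj.le]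
  simp only [Coeffs.update, Function.update_of_ne hj.ne]

lemma solvesAt_update_self : (a.update n u₁ u₂ p q).SolvesAt ν f₁ n ↔
    SolvesOrder ν (momentumSource ν f₁ a n) (pressureSource ν a n) u₁ u₂ p q := by
  unfold Coeffs.SolvesAt
  rw [momentumSource_update le_rfl, pressureSource_update le_rfl]
  simp only [Coeffs.update, Function.update_self]

lemma exists_forall_solvesAt (hν : IsSmoothPeriodic ν) (hpos : ∀ s, 0 < ν s)
    (hf : IsSmoothPeriodic f₁) (n : ℕ) : ∃ a : Coeffs, ∀ j < n, a.SolvesAt ν f₁ j := by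
  induction n with
  | zero => exact ⟨⟨0, 0, 0, 0⟩, fun j hj => absurd hj j.not_lt_zero⟩
  | succ n ih =>
    obtain ⟨a, ha⟩ := ih
    obtain ⟨u₁, u₂, p, q, hn⟩ := exists_solvesOrder hν hpos
      (momentumSource_mem_profiles hν hf ha) (pressureSource_mem_profiles hν ha)
    refine ⟨a.update n u₁ u₂ p q, fun j hj => ?_⟩
    rcases Nat.lt_succ_iff_lt_or_eq.1 hj with hj | rfl
    · exact (solvesAt_update_of_lt hj).2 (ha j hj)
    · exact solvesAt_update_self.2 hn

lemma isAnsatz_of_forall_solvesAt (h : ∀ j ≤ k, a.SolvesAt ν f₁ j) : IsAnsatz ν f₁ k a where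
  smooth_u₁ j hj := contDiff_two_of_mem_profiles (h j hj).mem_u₁
  smooth_u₂ j hj := contDiff_two_of_mem_profiles (h j hj).mem_u₂
  smooth_p j hj := (contDiff_two_of_mem_profiles (h j hj).mem_p).of_le one_le_two
  smooth_q j hj := (h j hj).smooth_q.smooth.of_le (mod_cast le_top)
  per_u₁ j hj s ξ _ := periodic_of_mem_profiles (h j hj).mem_u₁ s ξ
  per_u₂ j hj s ξ _ := periodic_of_mem_profiles (h j hj).mem_u₂ s ξ
  per_p j hj s ξ _ := periodic_of_mem_profiles (h j hj).mem_p s ξ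
  per_q j hj := (h j hj).smooth_q.periodic
  mean_p j hj := (h j hj).mean_p
  momentum₁ j hj x _ := by
    have hmomentum := (h j hj).momentum₁ x
    unfold momentumSource at hmomentum
    linarith
  momentum₂ j hj x _ := sub_eq_zero.2 (congrFun (h j hj).momentum₂ x).symm
  incompressible j hj x _ := (h j hj).incompressible x
  bdry_u₁ j hj := (h j hj).bdry_u₁
  bdry_u₂ j hj := (h j hj).bdry_u₂

lemma exists_isAnsatz_of_isSmoothPeriodic (hν : IsSmoothPeriodic ν) (hpos : ∀ s, 0 < ν s)
    (hf : IsSmoothPeriodic f₁) (k : ℕ) : ∃ a, IsAnsatz ν f₁ k a := by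
  obtain ⟨a, ha⟩ := exists_forall_solvesAt hν hpos hf (k + 1)
  exact ⟨a, isAnsatz_of_forall_solvesAt fun j hj => ha j (Nat.lt_succ_of_le hj)⟩

lemma IsAnsatz.add_deriv_force {g : ℝ → ℝ} (ha : IsAnsatz ν f₁ k a) (hg : ContDiff ℝ 1 g)
    (hg_per : Function.Periodic g 1) :
    ∃ b, IsAnsatz ν (fun s => f₁ s + deriv g s) k b := by
  refine ⟨{ a with q := fun j => if j = 0 then fun s => a.q 0 s + g s else a.q j },
    { ha with smooth_q := fun j hj => ?_, per_q := fun j hj => ?_,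
              momentum₁ := fun j hj x hx => ?_ }⟩
  · dsimp only
    split_ifs
    exacts [(ha.smooth_q 0 k.zero_le).add hg, ha.smooth_q j hj]
  · dsimp only
    split_ifs
    exacts [(ha.per_q 0 k.zero_le).add hg_per, ha.per_q j hj]
  · have hmomentum := ha.momentum₁ j hj x hx
    rcases eq_or_ne j 0 with rfl | hj₀
    · have hderiv : deriv (fun s => a.q 0 s + g s) x.1 = deriv (a.q 0) x.1 + deriv g x.1 :=
        deriv_fun_add ((ha.smooth_q 0 k.zero_le).differentiable one_ne_zero _)
          (hg.differentiable one_ne_zero _)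
      simp only [if_true, hderiv] at hmomentum ⊢
      linarith
    · simpa only [hj₀, if_false] using hmomentum

lemma exists_isAnsatz_of_forall_const_mul (hν : Continuous ν) (hν_per : Function.Periodic ν 1)
    (hpos : ∀ s, 0 < ν s) (hf : Continuous f₁) (hf_per : Function.Periodic f₁ 1)
    (h : ∀ c : ℝ, ∃ a, IsAnsatz ν (fun s => c * ν s) k a) : ∃ a, IsAnsatz ν f₁ k a := by
  obtain ⟨c, g, hg, hg_per, hfg⟩ := exists_eq_const_mul_add_deriv hν hν_per hpos hf hf_per
  obtain ⟨a, ha⟩ := h c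
  have hderiv : deriv g = fun s => f₁ s - c * ν s := funext fun s => by rw [hfg]; ring
  have hg' : ContDiff ℝ 1 g := contDiff_one_iff_deriv.2 ⟨hg, by rw [hderiv]; fun_prop⟩
  rw [funext hfg]
  exact ha.add_deriv_force hg' hg_per

section Poiseuille

variable {c : ℝ}

/-- The Poiseuille flow driven by the force `c ν(x₁) e₁`; the variation of the viscosity only
enters through the pressure of index `1`. -/
def poiseuilleCoeffs (ν : ℝ → ℝ) (c : ℝ) : Coeffs where
  u₁ j := if j = 0 then fun x => -c * (x.2 ^ 2 - 1 / 4) else 0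
  u₂ := 0
  p j := if j = 1 then fun x => -(c / 2) * deriv ν x.1 * (x.2 ^ 2 - 1 / 12) else 0
  q := 0

lemma pd_one_fst_mul_sq_sub {f : ℝ → ℝ} (hf : Differentiable ℝ f) (r : ℝ) :
    pd 1 (fun y => f y.1 * (y.2 ^ 2 - r)) = fun y => f y.1 * (2 * y.2) := by
  rw [pd_one_fst_mul_snd (g := fun t => t ^ 2 - r) hf (by fun_prop)]
  simp

lemma back_zero (j m : ℕ) : back (0 : ℕ → ℝ × ℝ → ℝ) j m = 0 := by
  unfold back
  split_ifs <;> rfl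

lemma pd_zero_poiseuille_u₁ (j : ℕ) : pd 0 ((poiseuilleCoeffs ν c).u₁ j) = 0 := by
  dsimp only [poiseuilleCoeffs]
  split_ifs
  · rw [pd_zero_fst_mul_snd (f := fun _ => -c) (g := fun t => t ^ 2 - 1 / 4) (by fun_prop)
      (by fun_prop)]
    simp only [deriv_const, zero_mul]
    rfl
  · exact pd_zero

lemma pd_one_poiseuille_u₁_zero :
    pd 1 ((poiseuilleCoeffs ν c).u₁ 0) = fun x => -c * (2 * x.2) :=
  pd_one_fst_mul_sq_sub (f := fun _ => -c) (by fun_prop) _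

lemma pd_one_pd_one_poiseuille_u₁_zero :
    pd 1 (pd 1 ((poiseuilleCoeffs ν c).u₁ 0)) = fun _ => -c * 2 := by
  rw [pd_one_poiseuille_u₁_zero,
    pd_one_fst_mul_snd (f := fun _ => -c) (g := fun t => 2 * t) (by fun_prop) (by fun_prop)]
  simp

lemma integral_poiseuille_p (j : ℕ) (s : ℝ) :
    ∫ ξ in (-(1 / 2) : ℝ)..(1 / 2), (poiseuilleCoeffs ν c).p j (s, ξ) = 0 := by
  dsimp only [poiseuilleCoeffs]
  split_ifs
  · simp only
    rw [intervalIntegral.integral_const_mul, intervalIntegral.integral_sub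
      ((continuous_pow 2).intervalIntegrable _ _) (continuous_const.intervalIntegrable _ _),
      integral_pow, intervalIntegral.integral_const]
    norm_num
  · exact intervalIntegral.integral_zero

lemma poiseuille_momentum₁ (hj : j ≤ 1) (x : ℝ × ℝ) :
    ν x.1 / 2 * pd 1 (pd 1 ((poiseuilleCoeffs ν c).u₁ j)) x =
      momentumSource ν (fun s => c * ν s) (poiseuilleCoeffs ν c) j x := by
  have hu₁ : back (poiseuilleCoeffs ν c).u₁ j 2 = 0 := if_neg (by omega)
  have hu₂ : back (poiseuilleCoeffs ν c).u₂ j 2 = 0 := back_zero j 2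
  have hp : back (poiseuilleCoeffs ν c).p j 1 = 0 := by
    obtain rfl | rfl := Nat.le_one_iff_eq_zero_or_eq_one.1 hj <;> rfl
  simp only [momentumSource, hu₁, hu₂, hp, pd_zero, Pi.zero_apply, mul_zero]
  rcases Nat.le_one_iff_eq_zero_or_eq_one.1 hj with rfl | rfl
  · rw [pd_one_pd_one_poiseuille_u₁_zero, pd_const, if_pos rfl]
    ring
  · have hu₁' : (poiseuilleCoeffs ν c).u₁ 1 = 0 := rfl
    simp only [hu₁', pd_zero, pd_const, Pi.zero_apply, one_ne_zero, if_false, mul_zero, neg_zero,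
      sub_zero, add_zero]

lemma poiseuille_momentum₂ (hν : ContDiff ℝ 2 ν) (hj : j ≤ 1) :
    pd 1 ((poiseuilleCoeffs ν c).p j) = pressureSource ν (poiseuilleCoeffs ν c) j := by
  have hu₂ (m) : back (poiseuilleCoeffs ν c).u₂ j m = 0 := back_zero j m
  funext x
  simp only [pressureSource, hu₂, pd_zero, Pi.zero_apply, add_zero, mul_zero]
  rcases Nat.le_one_iff_eq_zero_or_eq_one.1 hj with rfl | rfl
  · have hu₁ : back (poiseuilleCoeffs ν c).u₁ 0 1 = 0 := rfl
    have hp : (poiseuilleCoeffs ν c).p 0 = 0 := rfl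
    simp only [hu₁, hp, pd_zero, Pi.zero_apply, mul_zero, pd_const]
  · have hu₁ : back (poiseuilleCoeffs ν c).u₁ 1 1 = (poiseuilleCoeffs ν c).u₁ 0 := rfl
    have hp : (poiseuilleCoeffs ν c).p 1 = fun x => -(c / 2) * deriv ν x.1 * (x.2 ^ 2 - 1 / 12) :=
      rfl
    have hν' : Differentiable ℝ (deriv ν) := (hν.deriv').differentiable one_ne_zero
    rw [hu₁, pd_one_poiseuille_u₁_zero, hp,
      pd_one_fst_mul_sq_sub (f := fun s => -(c / 2) * deriv ν s) (hν'.const_mul _),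
      pd_zero_fst_mul_snd (g := fun t => -c * (2 * t)) (hν.differentiable two_ne_zero)
        (by fun_prop)]
    ring

lemma isAnsatz_poiseuilleCoeffs (hν : ContDiff ℝ 2 ν) (hν_per : Function.Periodic ν 1) (c : ℝ)
    (hk : k ≤ 1) : IsAnsatz ν (fun s => c * ν s) k (poiseuilleCoeffs ν c) where
  smooth_u₁ j _ := by
    dsimp only [poiseuilleCoeffs]
    split_ifs
    exacts [by fun_prop, contDiff_const]
  smooth_u₂ _ _ := contDiff_const
  smooth_p j _ := by
    have : ContDiff ℝ 1 (deriv ν) := hν.deriv'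
    dsimp only [poiseuilleCoeffs]
    split_ifs
    exacts [by fun_prop, contDiff_const]
  smooth_q _ _ := contDiff_const
  per_u₁ j _ s ξ _ := by
    dsimp only [poiseuilleCoeffs]
    split_ifs <;> rfl
  per_u₂ _ _ _ _ _ := rfl
  per_p j _ s ξ _ := by
    dsimp only [poiseuilleCoeffs]
    split_ifs
    exacts [by simp only [periodic_deriv hν_per s], rfl]
  per_q _ _ _ := rfl
  mean_p j _ := integral_poiseuille_p j
  momentum₁ j hj x _ := by
    have hmomentum := poiseuille_momentum₁ (ν := ν) (c := c) (hj.trans hk) x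
    have hq : deriv ((poiseuilleCoeffs ν c).q j) x.1 = 0 := deriv_const _ _
    unfold momentumSource at hmomentum
    linarith
  momentum₂ j hj x _ := sub_eq_zero.2 (congrFun (poiseuille_momentum₂ hν (hj.trans hk)) x).symm
  incompressible j _ x _ := by
    rw [pd_zero_poiseuille_u₁]
    change (0 : ℝ) + pd 1 (0 : ℝ × ℝ → ℝ) x = 0
    rw [pd_zero, Pi.zero_apply, add_zero]
  bdry_u₁ j _ s := by
    dsimp only [poiseuilleCoeffs]
    split_ifs
    · constructor <;> ring
    · exact ⟨rfl, rfl⟩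
  bdry_u₂ _ _ _ := ⟨rfl, rfl⟩

end Poiseuille

end Existence

end ThinStokes

end

open ThinStokes in
theorem mainTheorem3_general (ν f₁ : ℝ → ℝ) (κ : ℝ) (hκ : 0 < κ)
    (hν : ContDiff ℝ 2 ν) (hν_per : Function.Periodic ν 1)
    (hν_pos : ∀ s ∈ Set.Ioo (0 : ℝ) 1, κ ≤ ν s)
    (hf : Continuous f₁) (hf_per : Function.Periodic f₁ 1) (k : ℕ) :
    ((ContDiff ℝ ∞ ν ∨ k ≤ 1) → ∃ a : Coeffs, IsAnsatz ν f₁ k a) ∧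
    ∀ a : Coeffs, IsAnsatz ν f₁ k a →
      ∃ C : ℝ, ∀ ε : ℝ, 0 < ε → ε ≤ 1 → ∀ u G, IsWeakSolution ν f₁ ε u G →
        h1Norm (strip ε) (fun i => a.velocity k ε i - u i)
            ≤ ENNReal.ofReal (C * ε ^ ((k : ℝ) + 5 / 2)) ∧
        ∀ p : 𝓓'(strip ε, ℝ), IsPressure ν f₁ ε G p →
          hMinusOneNorm (strip ε) (fun i =>
              grad (funDistribution (strip ε) (a.pressure k ε)) i - grad p i)
            ≤ ENNReal.ofReal (C * ε ^ ((k : ℝ) + 5 / 2)) := by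
  have hpos (s) : 0 < ν s := hκ.trans_le (le_of_periodic hν.continuous hν_per hν_pos s)
  refine ⟨fun h => ?_, fun a ha =>
    ha.exists_error_le hκ (hν.of_le one_le_two) hν_per hν_pos hf⟩
  refine exists_isAnsatz_of_forall_const_mul hν.continuous hν_per hpos hf hf_per fun c => ?_
  rcases h with hν_smooth | hk
  · have hν' : IsSmoothPeriodic ν := ⟨hν_smooth, hν_per⟩
    exact exists_isAnsatz_of_isSmoothPeriodic hν' hpos ((IsSmoothPeriodic.const c).mul hν') k
  · exact ⟨_, isAnsatz_poiseuilleCoeffs hν hν_per c hk⟩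

theorem mainTheorem3 (ν f₁ : ℝ → ℝ) (κ : ℝ) (hκ : 0 < κ)
    (hν : ContDiff ℝ 2 ν) (hν_per : Function.Periodic ν 1)
    (hν_pos : ∀ s ∈ Set.Ioo (0 : ℝ) 1, κ ≤ ν s)
    (hf : ContDiff ℝ ∞ f₁) (hf_per : Function.Periodic f₁ 1) (k : ℕ) :
    ((ContDiff ℝ ∞ ν ∨ k ≤ 1) → ∃ a : ThinStokes.Coeffs, ThinStokes.IsAnsatz ν f₁ k a) ∧
    ∀ a : ThinStokes.Coeffs, ThinStokes.IsAnsatz ν f₁ k a →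
      ∃ C : ℝ, ∀ ε : ℝ, 0 < ε → ε ≤ 1 →
        ∀ u G, ThinStokes.IsWeakSolution ν f₁ ε u G →
          ThinStokes.h1Norm (ThinStokes.strip ε) (fun i => a.velocity k ε i - u i)
              ≤ ENNReal.ofReal (C * ε ^ ((k : ℝ) + 5 / 2)) ∧
          ∀ p : 𝓓'(ThinStokes.strip ε, ℝ), ThinStokes.IsPressure ν f₁ ε G p →
            ThinStokes.hMinusOneNorm (ThinStokes.strip ε) (fun i =>
                ThinStokes.grad
                  (ThinStokes.funDistribution (ThinStokes.strip ε) (a.pressure k ε)) i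
                  - ThinStokes.grad p i)
              ≤ ENNReal.ofReal (C * ε ^ ((k : ℝ) + 5 / 2)) :=
  mainTheorem3_general ν f₁ κ hκ hν hν_per hν_pos hf.continuous hf_per k
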